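/- Let $\nu\ge 1$ and let $\mathcal A$ be the Fermion (CAR) $C^*$-algebra over the lattice $\mathbb Z^\nu$, generated by annihilation and creation operators $a_i,a_i^*$ ($i\in\mathbb Z^\nu$) with $a_ia_j+a_ja_i=0$ and $a_i^*a_j+a_ja_i^*=\delta_{ij}\mathbf 1$. For $I\subset\mathbb Z^\nu$ let $\mathcal A(I)$ be the $C^*$-subalgebra generated by $a_i,a_i^*$, $i\in I$ (with $\mathcal A(\emptyset)=\mathbb C\mathbf 1$). Let $\tau$ be the tracial state of $\mathcal A$, let $\Theta$ be the automorphism with $\Theta(a_i)=-a_i$, let $\tau_k$ ($k\in\mathbb Z^\nu$) be the automorphism with $\tau_k(a_i)=a_{i+k}$, and let $E_I$ be the $\tau$-preserving conditional expectation onto $\mathcal A(I)$, i.e. $E_I(a)\in\mathcal A(I)$ and $\tau(E_I(a)b)=\tau(ab)$ for $b\in\mathcal A(I)$. Let $\mathcal P_\tau$ be the real vector space of translation covariant standard potentials, that is, of functions $\Phi$ assigning to each finite $I\subset\mathbb Z^\nu$ an element $\Phi(I)$ with: $\Phi(I)\in\mathcal A(I)$ and $\Phi(\emptyset)=0$; $\Phi(I)^*=\Phi(I)$;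 $\Theta(\Phi(I))=\Phi(I)$; $E_J(\Phi(I))=0$ for $J\subsetneq I$; for each finite $I$, the net $H_J(I)=\sum\{\Phi(K):K\subset J,\ K\cap I\neq\emptyset\}$, indexed by the finite sets $J$ ordered by inclusion, is norm-Cauchy; and $\tau_k(\Phi(I))=\Phi(I+k)$ for all $k\in\mathbb Z^\nu$. For $\Phi\in\mathcal P_\tau$ put $H_\Phi(I)=\lim_J H_J(I)$, $U_\Phi(I)=E_I(H_\Phi(I))$ and $\|\Phi\|=\|H_\Phi(\{n\})\|$, which does not depend on $n\in\mathbb Z^\nu$. A net $\{I_\alpha\}$ of (eventually nonempty) finite subsets of $\mathbb Z^\nu$, indexed by a directed set, is a van Hove net if for every $r>0$ $$\lim_\alpha \frac{|\{n\in I_\alpha:\ |n-m|\le r\ \text{for some}\ m\in\mathbb Z^\nu\setminus I_\alpha\}|}{|I_\alpha|}=0 ,$$ where $|n-m|$ is the Euclidean distance. A real function $f$ of finite subsets has the van Hove limit $L$, written $\mathrm{v.H.}\lim_{I\to\infty}f(I)=L$, if $\lim_\alpha f(I_\alpha)=L$ for every van Hove net $\{I_\alpha\}$. Theorem. (1) For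 every $\Phi\in\mathcal P_\tau$ the following van Hove limits exist and are equal: $$p(\Phi):=\mathrm{v.H.}\lim_{I\to\infty}\frac1{|I|}\log\tau\bigl(e^{-H_\Phi(I)}\bigr)=\mathrm{v.H.}\lim_{I\to\infty}\frac1{|I|}\log\tau\bigl(e^{-U_\Phi(I)}\bigr).$$ (2) The functional $p$ is convex on $\mathcal P_\tau$ and satisfies $|p(\Phi)-p(\Psi)|\le\|\Phi-\Psi\|$ for all $\Phi,\Psi\in\mathcal P_\tau$. -/

import Mathlib

universe w

noncomputable section

open Filter Topology

namespace Fermion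

section SignedPermutations

variable {ι : Type*}

/-- The operator `(U f)(t) = u t * f (e t)` on `ℓ²(ι)`, for signs `u` and a permutation `e`. -/
def signedPerm (u : ι → ℤˣ) (e : Equiv.Perm ι) :
    lp (fun _ : ι => ℂ) 2 →L[ℂ] lp (fun _ : ι => ℂ) 2 :=
  LinearIsometry.toContinuousLinearMap
    { toFun := fun f => ⟨fun t => ((u t : ℤ) : ℂ) * f (e t), by
        have hf := (lp.memℓp f).summable (by norm_num)
        refine memℓp_gen ?_
        refine (e.summable_iff.mpr hf).congr fun t => ?_
        rcases Int.units_eq_one_or (u t) with h | h <;> simp [h]⟩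
      map_add' := fun f g => by
        ext t
        change _ * (f (e t) + g (e t)) = _ * f (e t) + _ * g (e t)
        ring
      map_smul' := fun c f => by
        ext t
        change _ * (c * f (e t)) = c * (_ * f (e t))
        ring
      norm_map' := fun f => by
        have h2 : 0 < (2 : ENNReal).toReal := by norm_num
        rw [lp.norm_eq_tsum_rpow h2, lp.norm_eq_tsum_rpow h2]
        congr 1
        rw [← e.tsum_eq (fun t => ‖f t‖ ^ (2 : ENNReal).toReal)]
        refine tsum_congr fun t => ?_
        change ‖((u t : ℤ) : ℂ) * f (e t)‖ ^ _ = _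
        rcases Int.units_eq_one_or (u t) with h | h <;> simp [h] }

theorem signedPerm_apply (u : ι → ℤˣ) (e : Equiv.Perm ι) (f : lp (fun _ : ι => ℂ) 2) (t : ι) :
    signedPerm u e f t = ((u t : ℤ) : ℂ) * f (e t) := rfl

theorem signedPerm_mul (u v : ι → ℤˣ) (e e' : Equiv.Perm ι) :
    signedPerm u e * signedPerm v e' = signedPerm (fun t => u t * v (e t)) (e.trans e') := by
  ext f t
  change ((u t : ℤ) : ℂ) * (((v (e t) : ℤ) : ℂ) * f (e' (e t))) = _
  rw [signedPerm_apply]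
  push_cast
  rw [mul_assoc]
  rfl

theorem signedPerm_one : signedPerm (fun _ : ι => 1) (Equiv.refl ι) = 1 := by
  ext f t
  rw [signedPerm_apply]
  simp

theorem signedPerm_star (u : ι → ℤˣ) (e : Equiv.Perm ι) :
    star (signedPerm u e) = signedPerm (fun t => u (e.symm t)) e.symm := by
  symm
  rw [ContinuousLinearMap.star_eq_adjoint, ContinuousLinearMap.eq_adjoint_iff]
  intro f g
  rw [lp.inner_eq_tsum, lp.inner_eq_tsum, ← e.tsum_eq]
  refine tsum_congr fun t => ?_
  rw [signedPerm_apply, signedPerm_apply]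
  simp
  ring

theorem signedPerm_mem_unitary (u : ι → ℤˣ) (e : Equiv.Perm ι) :
    signedPerm u e ∈ unitary (lp (fun _ : ι => ℂ) 2 →L[ℂ] lp (fun _ : ι => ℂ) 2) := by
  rw [Unitary.mem_iff, signedPerm_star, signedPerm_mul, signedPerm_mul, ← signedPerm_one]
  constructor <;> congr 1 <;> (ext t; simp [Int.units_mul_self])

end SignedPermutations

/-- The lattice `ℤ^ν`. -/
abbrev Site (ν : ℕ) := Fin ν → ℤ

/-- Two self-adjoint (Majorana) generators `a_i + a_i^*` and `-i (a_i - a_i^*)` per lattice site,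
labelled by `false` and `true`. -/
abbrev Mode (ν : ℕ) := Site ν × Bool

/-- `ℓ²` over the finite sets of modes: the Hilbert space with an orthonormal basis `(e_S)` labelled
by the ordered monomials in the Majorana generators, i.e. the GNS space of the tracial state. -/
abbrev Hil (ν : ℕ) := lp (fun _ : Finset (Mode ν) => ℂ) 2

/-- The bounded operators on `Hil ν`. -/
abbrev Op (ν : ℕ) := Hil ν →L[ℂ] Hil ν

variable {ν : ℕ}

/-- The lexicographic order on modes. -/
def Before (x y : Mode ν) : Prop :=
  toLex x.1 < toLex y.1 ∨ (x.1 = y.1 ∧ x.2 < y.2)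

open Classical in
/-- The sign picked up when the generator `x` standing on the left of `y` is brought into increasing
order. -/
def swapSign (x y : Mode ν) : ℤˣ := if Before y x then -1 else 1

/-- The sign in `e_S e_T = reorderSign S T • e_{S ∆ T}`. -/
def reorderSign (S T : Finset (Mode ν)) : ℤˣ := ∏ x ∈ S, ∏ y ∈ T, swapSign x y

/-- `T ↦ S ∆ T`. -/
def symmDiffPerm (S : Finset (Mode ν)) : Equiv.Perm (Finset (Mode ν)) where
  toFun T := symmDiff S T
  invFun T := symmDiff S T
  left_inv T := by simp
  right_inv T := by simp

/-- Left multiplication by the ordered monomial with label `S`: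
`monomial S e_T = reorderSign S T • e_{S ∆ T}`. -/
def monomial (S : Finset (Mode ν)) : Op ν :=
  signedPerm (fun T => reorderSign S (symmDiff S T)) (symmDiffPerm S)

/-- The annihilation operator at the site `i`; the creation operator is `star (ann i)`. The
canonical anticommutation relations are proved in `ann_mul_ann_add` and `star_ann_mul_ann_add`. -/
def ann (i : Site ν) : Op ν :=
  (1 / 2 : ℂ) • (monomial {(i, false)} + Complex.I • monomial {(i, true)})

/-- The `C*`-algebra generated by `a_i`, `a_i^*` for `i ∈ I`. -/
def localAlgebra (I : Set (Site ν)) : StarSubalgebra ℂ (Op ν) :=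
  (StarAlgebra.adjoin ℂ (ann '' I)).topologicalClosure

variable (ν) in
/-- The Fermion (CAR) `C*`-algebra over `ℤ^ν`, generated by all `a_i`, `a_i^*`. -/
def carAlgebra : StarSubalgebra ℂ (Op ν) := localAlgebra Set.univ

/-- The vector `e_∅`. -/
def vacuum : Hil ν := lp.single 2 ∅ 1

/-- The tracial state `τ` of the Fermion algebra: it is normalized (`trace_one`), positive
(`trace_star_mul_self_nonneg`) and tracial on the Fermion algebra (`trace_mul_comm`). -/
def trace (x : Op ν) : ℂ := inner ℂ vacuum (x vacuum)

variable (ν) in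
/-- The unitary `e_S ↦ (-1)^|S| e_S`. -/
def parityUnitary : unitary (Op ν) :=
  ⟨signedPerm (fun S => (-1) ^ S.card) (Equiv.refl _), signedPerm_mem_unitary _ _⟩

variable (ν) in
/-- The automorphism `Θ`, with `Θ(a_i) = -a_i` (`theta_ann`). -/
def theta : Op ν ≃⋆ₐ[ℂ] Op ν := Unitary.conjStarAlgAut ℂ (Op ν) (parityUnitary ν)

/-- Translation of modes. -/
def modeShift (k : Site ν) : Equiv.Perm (Mode ν) :=
  (Equiv.addRight k).prodCongr (Equiv.refl Bool)

/-- The unitary `e_S ↦ e_{S+k}`. -/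
def shiftUnitary (k : Site ν) : unitary (Op ν) :=
  ⟨signedPerm (fun _ => 1) ((modeShift k).finsetCongr).symm, signedPerm_mem_unitary _ _⟩

/-- The lattice translation automorphism `τ_k`, with `τ_k(a_i) = a_{i+k}` (`shift_ann`). -/
def shift (k : Site ν) : Op ν ≃⋆ₐ[ℂ] Op ν := Unitary.conjStarAlgAut ℂ (Op ν) (shiftUnitary k)

/-- The conditional expectation `E_I` onto the local algebra of a finite set `I`, written in the
orthonormal system of monomials located in `I`. It takes values in `localAlgebra I` (`condExp_mem`)
and satisfies `τ(E_I(x) b) = τ(x b)` for `b ∈ localAlgebra I` (`trace_condExp_mul`). -/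
def condExp (I : Finset (Site ν)) (x : Op ν) : Op ν :=
  ∑ S ∈ (I ×ˢ (Finset.univ : Finset Bool)).powerset, trace (star (monomial S) * x) • monomial S

section Properties

theorem before_irrefl (x : Mode ν) : ¬ Before x x := by
  rintro (h | h)
  · exact lt_irrefl _ h
  · exact lt_irrefl _ h.2

theorem before_trichotomy {x y : Mode ν} (h : x ≠ y) : Before x y ↔ ¬ Before y x := by
  obtain ⟨i, b⟩ := x
  obtain ⟨j, c⟩ := y
  have key : ∀ i j : Lex (Fin ν → ℤ), i < j ∨ i = j ∨ j < i := lt_trichotomy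
  have key2 : ∀ {i j : Lex (Fin ν → ℤ)}, i < j → ¬ j < i := fun h => lt_asymm h
  have key3 : ∀ i : Lex (Fin ν → ℤ), ¬ i < i := fun i => lt_irrefl i
  simp only [Before]
  rcases key (toLex i) (toLex j) with hij | hij | hij
  · have h1 : i ≠ j := fun e => key3 (toLex j) (by rwa [e] at hij)
    have := key2 hij
    tauto
  · have h1 : i = j := hij
    subst h1
    have h2 : b ≠ c := fun e => h (by rw [e])
    have := key3 (toLex i)
    cases b <;> cases c <;> simp_all
  · have h1 : i ≠ j := fun e => key3 (toLex j) (by rwa [e] at hij)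
    have := key2 hij
    tauto

theorem prod_symmDiff (g : Mode ν → ℤˣ) (S T : Finset (Mode ν)) :
    ∏ x ∈ symmDiff S T, g x = (∏ x ∈ S, g x) * ∏ x ∈ T, g x := by
  have hd : Disjoint (S \ T) (T \ S) := disjoint_sdiff_sdiff
  have h1 : (∏ x ∈ S ∩ T, g x) * (∏ x ∈ S \ T, g x) = ∏ x ∈ S, g x :=
    Finset.prod_inter_mul_prod_sdiff S T g
  have h2 : (∏ x ∈ T ∩ S, g x) * (∏ x ∈ T \ S, g x) = ∏ x ∈ T, g x :=
    Finset.prod_inter_mul_prod_sdiff T S g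
  rw [symmDiff_def, Finset.sup_eq_union, Finset.prod_union hd, ← h1, ← h2, Finset.inter_comm T S]
  have h3 := Int.units_mul_self (∏ x ∈ S ∩ T, g x)
  calc _ = ((∏ x ∈ S ∩ T, g x) * ∏ x ∈ S ∩ T, g x) *
        ((∏ x ∈ S \ T, g x) * ∏ x ∈ T \ S, g x) := by rw [h3, one_mul]
    _ = _ := by rw [mul_mul_mul_comm]

theorem reorderSign_symmDiff_left (S T R : Finset (Mode ν)) :
    reorderSign (symmDiff S T) R = reorderSign S R * reorderSign T R :=
  prod_symmDiff _ S T

theorem reorderSign_symmDiff_right (S T R : Finset (Mode ν)) :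
    reorderSign R (symmDiff S T) = reorderSign R S * reorderSign R T := by
  simp only [reorderSign, prod_symmDiff, Finset.prod_mul_distrib]

theorem monomial_empty : monomial (∅ : Finset (Mode ν)) = 1 := by
  rw [monomial, ← signedPerm_one]
  congr 1
  ext t : 1
  exact bot_symmDiff t

theorem monomial_mul (S T : Finset (Mode ν)) :
    monomial S * monomial T = ((reorderSign S T : ℤ) : ℂ) • monomial (symmDiff S T) := by
  ext f R
  rw [monomial, monomial, signedPerm_mul, signedPerm_apply]
  change _ = ((reorderSign S T : ℤ) : ℂ) * (monomial (symmDiff S T) f) R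
  rw [monomial, signedPerm_apply, ← mul_assoc]
  have hR : ((symmDiffPerm S).trans (symmDiffPerm T)) R = symmDiffPerm (symmDiff S T) R := by
    simp [symmDiffPerm, symmDiff_left_comm, symmDiff_assoc]
  rw [hR]
  congr 1
  simp only [symmDiffPerm, Equiv.coe_fn_mk, reorderSign_symmDiff_left, reorderSign_symmDiff_right]
  rcases Int.units_eq_one_or (reorderSign S S) with h1 | h1 <;>
  rcases Int.units_eq_one_or (reorderSign S T) with h2 | h2 <;>
  rcases Int.units_eq_one_or (reorderSign T T) with h3 | h3 <;>
  rcases Int.units_eq_one_or (reorderSign S R) with h4 | h4 <;>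
  rcases Int.units_eq_one_or (reorderSign T R) with h5 | h5 <;>
  rcases Int.units_eq_one_or (reorderSign T S) with h6 | h6 <;>
  simp [h1, h2, h3, h4, h5, h6]

theorem monomial_mul_self (S : Finset (Mode ν)) :
    monomial S * monomial S = ((reorderSign S S : ℤ) : ℂ) • (1 : Op ν) := by
  rw [monomial_mul, symmDiff_self, Finset.bot_eq_empty, monomial_empty]

theorem star_monomial (S : Finset (Mode ν)) :
    star (monomial S) = ((reorderSign S S : ℤ) : ℂ) • monomial S := by
  ext f R
  rw [monomial, signedPerm_star, signedPerm_apply]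
  change _ = ((reorderSign S S : ℤ) : ℂ) *
    (signedPerm (fun T => reorderSign S (symmDiff S T)) (symmDiffPerm S) f) R
  rw [signedPerm_apply, ← mul_assoc]
  congr 1
  simp only [symmDiffPerm, Equiv.coe_fn_symm_mk, reorderSign_symmDiff_right]
  rcases Int.units_eq_one_or (reorderSign S S) with h1 | h1 <;> simp [h1]

theorem reorderSign_singleton (x y : Mode ν) : reorderSign {x} {y} = swapSign x y := by
  simp [reorderSign]

theorem monomial_anticomm {x y : Mode ν} (h : x ≠ y) :
    monomial {x} * monomial {y} + monomial {y} * monomial {x} = (0 : Op ν) := by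
  rw [monomial_mul, monomial_mul, symmDiff_comm ({y} : Finset (Mode ν)) {x}, ← add_smul, reorderSign_singleton,
    reorderSign_singleton]
  have := before_trichotomy h
  by_cases h1 : Before y x <;> simp_all [swapSign]

theorem monomial_singleton_sq (x : Mode ν) : monomial {x} * monomial {x} = (1 : Op ν) := by
  rw [monomial_mul_self, reorderSign_singleton]
  simp [swapSign, before_irrefl]

theorem star_monomial_singleton (x : Mode ν) : star (monomial {x}) = (monomial {x} : Op ν) := by
  rw [star_monomial, reorderSign_singleton]
  simp [swapSign, before_irrefl]

theorem star_ann (i : Site ν) :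
    star (ann i) = (1 / 2 : ℂ) • (monomial {(i, false)} - Complex.I • monomial {(i, true)}) := by
  rw [ann, star_smul, star_add, star_smul, star_monomial_singleton, star_monomial_singleton]
  simp [sub_eq_add_neg]

/-- The canonical anticommutation relations. -/
theorem ann_mul_ann_add (i j : Site ν) : ann i * ann j + ann j * ann i = 0 := by
  simp only [ann, smul_mul_assoc, mul_smul_comm, add_mul, mul_add]
  by_cases h : i = j
  · subst h
    have h3 := monomial_anticomm (x := (i, false)) (y := (i, true)) (by simp)
    have h4 := eq_neg_of_add_eq_zero_left h3
    simp only [monomial_singleton_sq, h4, smul_smul]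
    match_scalars <;> first | (ring; done) | linear_combination (1 / 2 : ℂ) * Complex.I_mul_I
  · have e (b c : Bool) := eq_neg_of_add_eq_zero_left
      (monomial_anticomm (x := (i, b)) (y := (j, c)) (by simp [h]))
    simp only [e]
    module

theorem star_ann_mul_ann_add (i j : Site ν) :
    star (ann i) * ann j + ann j * star (ann i) = if i = j then 1 else 0 := by
  rw [star_ann]
  simp only [ann, smul_mul_assoc, mul_smul_comm, add_mul, mul_add, sub_mul, mul_sub]
  split_ifs with h
  · subst h
    have h3 := monomial_anticomm (x := (i, false)) (y := (i, true)) (by simp)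
    have h4 := eq_neg_of_add_eq_zero_left h3
    simp only [monomial_singleton_sq, h4, smul_smul, smul_sub, smul_add, smul_neg]
    match_scalars <;> first | (ring; done) | linear_combination (-1 / 2 : ℂ) * Complex.I_mul_I
  · have e (b c : Bool) := eq_neg_of_add_eq_zero_left
      (monomial_anticomm (x := (i, b)) (y := (j, c)) (by simp [h]))
    simp only [e]
    module

theorem inner_vacuum (x : Op ν) : trace x = (x vacuum) ∅ := by
  rw [trace, vacuum, lp.inner_single_left]
  simp

theorem trace_monomial (S : Finset (Mode ν)) :
    trace (monomial S) = if S = ∅ then 1 else 0 := by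
  rw [inner_vacuum, monomial, signedPerm_apply]
  have : symmDiffPerm S ∅ = S := symmDiff_bot S
  rw [this, vacuum]
  split_ifs with h
  · subst h
    simp [reorderSign]
  · rw [lp.single_apply_ne _ _ _ h, mul_zero]

theorem trace_add (x y : Op ν) : trace (x + y) = trace x + trace y := by
  simp [trace]

theorem trace_smul (c : ℂ) (x : Op ν) : trace (c • x) = c * trace x := by
  simp [trace]

theorem continuous_trace : Continuous (trace : Op ν → ℂ) := by
  unfold trace
  fun_prop

theorem trace_one : trace (1 : Op ν) = 1 := by
  rw [← monomial_empty, trace_monomial, if_pos rfl]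

open scoped ComplexOrder in
theorem trace_star_mul_self_nonneg (x : Op ν) : 0 ≤ trace (star x * x) := by
  have : trace (star x * x) = inner ℂ (x vacuum) (x vacuum) := by
    rw [trace, ContinuousLinearMap.star_eq_adjoint]
    exact ContinuousLinearMap.adjoint_inner_right x vacuum (x vacuum)
  rw [this, inner_self_eq_norm_sq_to_K]
  have h := Complex.zero_le_real.mpr (sq_nonneg ‖x vacuum‖)
  rw [Complex.ofReal_pow] at h
  exact h

theorem monomial_singleton_false (i : Site ν) : monomial {(i, false)} = ann i + star (ann i) := by
  rw [star_ann, ann]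
  module

theorem monomial_singleton_true (i : Site ν) :
    monomial {(i, true)} = (-Complex.I) • (ann i - star (ann i)) := by
  rw [star_ann, ann]
  match_scalars <;> first | (ring; done) | linear_combination Complex.I_mul_I

theorem ann_mem {I : Set (Site ν)} {i : Site ν} (h : i ∈ I) : ann i ∈ localAlgebra I :=
  StarSubalgebra.le_topologicalClosure _ (StarAlgebra.subset_adjoin ℂ _ ⟨i, h, rfl⟩)

theorem monomial_mem {I : Set (Site ν)} (S : Finset (Mode ν)) (h : ∀ x ∈ S, x.1 ∈ I) :
    monomial S ∈ localAlgebra I := by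
  induction S using Finset.induction_on with
  | empty => rw [monomial_empty]; exact one_mem _
  | insert x S hx ih =>
    have h1 : monomial {x} ∈ localAlgebra I := by
      have hi := ann_mem (h x (Finset.mem_insert_self x S))
      obtain ⟨i, b⟩ := x
      cases b
      · rw [monomial_singleton_false]
        exact add_mem hi (star_mem hi)
      · rw [monomial_singleton_true]
        exact SMulMemClass.smul_mem _ (sub_mem hi (star_mem hi))
    have h2 := ih fun y hy => h y (Finset.mem_insert_of_mem hy)
    have h3 := monomial_mul {x} S
    have h4 : symmDiff {x} S = insert x S := by
      ext y
      by_cases hy : y = x <;> simp_all [Finset.mem_symmDiff]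
    rw [h4] at h3
    have h5 : monomial (insert x S) =
        ((reorderSign {x} S : ℤ) : ℂ) • (monomial {x} * monomial S) := by
      rw [h3, smul_smul]
      rcases Int.units_eq_one_or (reorderSign {x} S) with h6 | h6 <;> simp [h6]
    rw [h5]
    exact SMulMemClass.smul_mem _ (mul_mem h1 h2)

/-- The span of the monomials located in `I`. -/
def monomialSpan (I : Set (Site ν)) : Submodule ℂ (Op ν) :=
  Submodule.span ℂ (monomial '' {S | ∀ x ∈ S, x.1 ∈ I})

theorem monomialSpan_mul {I : Set (Site ν)} {x y : Op ν} (hx : x ∈ monomialSpan I)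
    (hy : y ∈ monomialSpan I) : x * y ∈ monomialSpan I := by
  have h := Submodule.mul_mem_mul hx hy
  rw [monomialSpan, Submodule.span_mul_span] at h
  refine Submodule.span_le.mpr ?_ h
  rintro _ ⟨_, ⟨S, hS, rfl⟩, _, ⟨T, hT, rfl⟩, rfl⟩
  change monomial S * monomial T ∈ _
  rw [monomial_mul]
  refine Submodule.smul_mem _ _ (Submodule.subset_span ⟨_, fun x hx => ?_, rfl⟩)
  rw [Finset.mem_symmDiff] at hx
  rcases hx with hx | hx
  · exact hS x hx.1
  · exact hT x hx.1

theorem monomialSpan_star {I : Set (Site ν)} {x : Op ν} (hx : x ∈ monomialSpan I) :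
    star x ∈ monomialSpan I := by
  induction hx using Submodule.span_induction with
  | mem x h =>
    obtain ⟨S, hS, rfl⟩ := h
    rw [star_monomial]
    exact Submodule.smul_mem _ _ (Submodule.subset_span ⟨S, hS, rfl⟩)
  | zero => simp
  | add x y _ _ hx hy => rw [star_add]; exact add_mem hx hy
  | smul c x _ hx => rw [star_smul]; exact Submodule.smul_mem _ _ hx

theorem adjoin_subset_monomialSpan {I : Set (Site ν)} {x : Op ν}
    (hx : x ∈ StarAlgebra.adjoin ℂ (ann '' I)) : x ∈ monomialSpan I := by
  have hm : ∀ i ∈ I, ∀ b, monomial {(i, b)} ∈ monomialSpan I := fun i hi b =>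
    Submodule.subset_span ⟨_, fun x hx => by rw [Finset.mem_singleton.mp hx]; exact hi, rfl⟩
  have h1 : (1 : Op ν) ∈ monomialSpan I :=
    Submodule.subset_span ⟨∅, by simp, monomial_empty⟩
  induction hx using StarAlgebra.adjoin_induction with
  | mem x h =>
    obtain ⟨i, hi, rfl⟩ := h
    exact Submodule.smul_mem _ _ (add_mem (hm i hi _) (Submodule.smul_mem _ _ (hm i hi _)))
  | algebraMap r => rw [Algebra.algebraMap_eq_smul_one]; exact Submodule.smul_mem _ _ h1
  | add x y _ _ hx hy => exact add_mem hx hy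
  | mul x y _ _ hx hy => exact monomialSpan_mul hx hy
  | star x _ hx => exact monomialSpan_star hx

theorem localAlgebra_subset_closure {I : Set (Site ν)} {x : Op ν} (hx : x ∈ localAlgebra I) :
    x ∈ closure (monomialSpan I : Set (Op ν)) :=
  closure_mono (fun _ h => adjoin_subset_monomialSpan h) hx

theorem localAlgebra_mono {I J : Set (Site ν)} (h : I ⊆ J) : localAlgebra I ≤ localAlgebra J :=
  StarSubalgebra.topologicalClosure_mono (StarAlgebra.adjoin_mono (Set.image_mono h))

theorem trace_monomial_mul (S T : Finset (Mode ν)) :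
    trace (monomial S * monomial T) = if S = T then ((reorderSign S S : ℤ) : ℂ) else 0 := by
  rw [monomial_mul, trace_smul, trace_monomial]
  by_cases h : S = T
  · subst h
    simp
  · have h' : symmDiff S T ≠ ∅ := fun h' => h (symmDiff_eq_bot.mp h')
    rw [if_neg h, if_neg h', mul_zero]

/-- The functional `trace` is tracial on the Fermion algebra. -/
theorem trace_mul_comm {x y : Op ν} (hx : x ∈ carAlgebra ν) (hy : y ∈ carAlgebra ν) :
    trace (x * y) = trace (y * x) := by
  have h1 : ∀ S : Finset (Mode ν), ∀ y ∈ monomialSpan (ν := ν) Set.univ,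
      trace (monomial S * y) = trace (y * monomial S) := by
    intro S y hy
    induction hy using Submodule.span_induction with
    | mem y h =>
      obtain ⟨T, -, rfl⟩ := h
      rw [trace_monomial_mul, trace_monomial_mul]
      by_cases h : S = T
      · subst h; rfl
      · rw [if_neg h, if_neg (Ne.symm h)]
    | zero => simp
    | add y z _ _ hy hz => rw [mul_add, add_mul, trace_add, trace_add, hy, hz]
    | smul c y _ hy => rw [mul_smul_comm, smul_mul_assoc, trace_smul, trace_smul, hy]
  have h2 : ∀ x ∈ monomialSpan (ν := ν) Set.univ, ∀ y ∈ monomialSpan (ν := ν) Set.univ,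
      trace (x * y) = trace (y * x) := by
    intro x hx y hy
    induction hx using Submodule.span_induction with
    | mem x h =>
      obtain ⟨S, -, rfl⟩ := h
      exact h1 S y hy
    | zero => simp
    | add x z _ _ hx hz => rw [mul_add, add_mul, trace_add, trace_add, hx, hz]
    | smul c x _ hx => rw [mul_smul_comm, smul_mul_assoc, trace_smul, trace_smul, hx]
  have h3 : ∀ p ∈ closure ((monomialSpan (ν := ν) Set.univ : Set (Op ν)) ×ˢ
      (monomialSpan (ν := ν) Set.univ : Set (Op ν))), trace (p.1 * p.2) = trace (p.2 * p.1) := by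
    refine closure_minimal (fun p hp => h2 _ hp.1 _ hp.2) (isClosed_eq ?_ ?_)
    · exact continuous_trace.comp (continuous_fst.mul continuous_snd)
    · exact continuous_trace.comp (continuous_snd.mul continuous_fst)
  refine h3 (x, y) ?_
  rw [closure_prod_eq]
  exact ⟨localAlgebra_subset_closure hx, localAlgebra_subset_closure hy⟩

theorem theta_monomial_singleton (x : Mode ν) :
    theta ν (monomial {x}) = -monomial {x} := by
  change signedPerm _ _ * monomial {x} * star (signedPerm _ _) = _
  rw [signedPerm_star, monomial, signedPerm_mul, signedPerm_mul]
  ext f T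
  rw [signedPerm_apply]
  change _ = -(signedPerm _ _ f T)
  rw [signedPerm_apply, ← neg_mul]
  congr 1
  have h := prod_symmDiff (fun _ => -1) {x} T
  simp only [Finset.prod_const, Finset.card_singleton, pow_one] at h
  simp only [symmDiffPerm, Equiv.coe_refl, id, Equiv.refl_symm, Equiv.trans_apply, Equiv.coe_fn_mk,
    h]
  rcases Int.units_eq_one_or (reorderSign {x} (symmDiff {x} T)) with h1 | h1 <;>
  rcases neg_one_pow_eq_or ℤˣ T.card with h2 | h2 <;> simp [h1, h2]

/-- `Θ(a_i) = -a_i`. -/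
theorem theta_ann (i : Site ν) : theta ν (ann i) = -ann i := by
  rw [ann, map_smul, map_add, map_smul, theta_monomial_singleton, theta_monomial_singleton]
  module

theorem before_modeShift (k : Site ν) (x y : Mode ν) :
    Before (modeShift k x) (modeShift k y) ↔ Before x y := by
  simp only [Before, modeShift, Equiv.prodCongr_apply, Prod.map, Equiv.coe_addRight,
    Equiv.coe_refl, id, add_left_inj]
  refine or_congr_left ?_
  change (∃ i, (∀ j < i, (x.1 + k) j = (y.1 + k) j) ∧ (x.1 + k) i < (y.1 + k) i) ↔
    (∃ i, (∀ j < i, x.1 j = y.1 j) ∧ x.1 i < y.1 i)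
  simp

theorem swapSign_modeShift (k : Site ν) (x y : Mode ν) :
    swapSign (modeShift k x) (modeShift k y) = swapSign x y := by
  have h := before_modeShift k y x
  by_cases h1 : Before y x
  · rw [swapSign, swapSign, if_pos h1, if_pos (h.mpr h1)]
  · rw [swapSign, swapSign, if_neg h1, if_neg (fun h2 => h1 (h.mp h2))]

theorem reorderSign_map (k : Site ν) (S T : Finset (Mode ν)) :
    reorderSign (S.map (modeShift k).toEmbedding) (T.map (modeShift k).toEmbedding) =
      reorderSign S T := by
  simp only [reorderSign, Finset.prod_map, Equiv.coe_toEmbedding, swapSign_modeShift]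

theorem shift_monomial (k : Site ν) (S : Finset (Mode ν)) :
    shift k (monomial S) = monomial (S.map (modeShift k).toEmbedding) := by
  change signedPerm _ _ * monomial S * star (signedPerm _ _) = _
  rw [signedPerm_star, monomial, monomial, signedPerm_mul, signedPerm_mul]
  ext f T
  rw [signedPerm_apply, signedPerm_apply]
  obtain ⟨R, rfl⟩ := (modeShift k).finsetCongr.surjective T
  have h : symmDiff (S.map (modeShift k).toEmbedding) (R.map (modeShift k).toEmbedding) =
      (symmDiff S R).map (modeShift k).toEmbedding := by
    ext x
    simp [Finset.mem_symmDiff]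
  have h' : (R.map (modeShift k).toEmbedding).map (modeShift k).symm.toEmbedding = R := by
    ext x
    simp
  simp [symmDiffPerm, h, h', reorderSign_map]

/-- `τ_k(a_i) = a_{i+k}`. -/
theorem shift_ann (k i : Site ν) : shift k (ann i) = ann (i + k) := by
  rw [ann, map_smul, map_add, map_smul, shift_monomial, shift_monomial]
  rfl

theorem condExp_mem (I : Finset (Site ν)) (x : Op ν) :
    condExp I x ∈ localAlgebra (I : Set (Site ν)) := by
  refine sum_mem fun S hS => SMulMemClass.smul_mem _ (monomial_mem S fun y hy => ?_)
  exact (Finset.mem_product.mp (Finset.mem_powerset.mp hS hy)).1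

/-- The characterizing property of the conditional expectation. -/
theorem trace_condExp_mul (I : Finset (Site ν)) {x b : Op ν} (hx : x ∈ carAlgebra ν)
    (hb : b ∈ localAlgebra (I : Set (Site ν))) : trace (condExp I x * b) = trace (x * b) := by
  have h1 : ∀ b ∈ monomialSpan (I : Set (Site ν)), trace (condExp I x * b) = trace (x * b) := by
    intro b hb
    induction hb using Submodule.span_induction with
    | mem b h =>
      obtain ⟨T, hT, rfl⟩ := h
      have hTm : T ∈ (I ×ˢ (Finset.univ : Finset Bool)).powerset :=
        Finset.mem_powerset.mpr fun y hy =>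
          Finset.mem_product.mpr ⟨hT y hy, Finset.mem_univ _⟩
      have hlin : trace (condExp I x * monomial T) =
          ∑ S ∈ (I ×ˢ (Finset.univ : Finset Bool)).powerset,
            trace (star (monomial S) * x) * trace (monomial S * monomial T) := by
        rw [condExp, Finset.sum_mul]
        generalize (I ×ˢ (Finset.univ : Finset Bool)).powerset = s
        induction s using Finset.induction_on with
        | empty => simp [trace]
        | insert a s ha ih =>
          rw [Finset.sum_insert ha, Finset.sum_insert ha, trace_add, ih, smul_mul_assoc, trace_smul]
      rw [hlin, Finset.sum_eq_single_of_mem T hTm]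
      · rw [trace_monomial_mul, if_pos rfl, star_monomial, smul_mul_assoc, trace_smul,
          trace_mul_comm (monomial_mem T fun _ _ => Set.mem_univ _) hx]
        rcases Int.units_eq_one_or (reorderSign T T) with h | h <;> simp [h]
      · intro S _ hS
        rw [trace_monomial_mul, if_neg hS, mul_zero]
    | zero => simp
    | add y z _ _ hy hz => rw [mul_add, mul_add, trace_add, trace_add, hy, hz]
    | smul c y _ hy => rw [mul_smul_comm, mul_smul_comm, trace_smul, trace_smul, hy]
  have h2 : ∀ b ∈ closure (monomialSpan (I : Set (Site ν)) : Set (Op ν)),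
      trace (condExp I x * b) = trace (x * b) :=
    closure_minimal h1 (isClosed_eq (continuous_trace.comp (continuous_const.mul continuous_id))
      (continuous_trace.comp (continuous_const.mul continuous_id)))
  exact h2 b (localAlgebra_subset_closure hb)

end Properties

/-- The translate `I + k`. -/
def translate (I : Finset (Site ν)) (k : Site ν) : Finset (Site ν) :=
  I.map (Equiv.addRight k).toEmbedding

/-- The finite sum `H_J(I) = ∑ {Φ(K) ; K ∩ I ≠ ∅, K ⊆ J}`. -/
def partialHamiltonian (Φ : Finset (Site ν) → Op ν) (I J : Finset (Site ν)) : Op ν :=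
  ∑ K ∈ J.powerset with (K ∩ I).Nonempty, Φ K

/-- The defining conditions of a standard potential. -/
structure IsStandardPotential (Φ : Finset (Site ν) → Op ν) : Prop where
  mem_local : ∀ I : Finset (Site ν), Φ I ∈ localAlgebra (I : Set (Site ν))
  empty : Φ ∅ = 0
  selfAdjoint : ∀ I, star (Φ I) = Φ I
  even : ∀ I, theta ν (Φ I) = Φ I
  standard : ∀ I J, J ⊂ I → condExp J (Φ I) = 0
  cauchy : ∀ I, CauchySeq (partialHamiltonian Φ I)

theorem condExp_add (I : Finset (Site ν)) (x y : Op ν) :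
    condExp I (x + y) = condExp I x + condExp I y := by
  simp only [condExp, mul_add, trace_add, add_smul, Finset.sum_add_distrib]

theorem real_smul_eq (c : ℝ) (x : Op ν) : c • x = (c : ℂ) • x := by
  ext f T
  change c • (x f T) = (c : ℂ) * x f T
  rw [Complex.real_smul]

theorem condExp_smul (I : Finset (Site ν)) (c : ℝ) (x : Op ν) :
    condExp I (c • x) = c • condExp I x := by
  simp only [condExp, real_smul_eq, mul_smul_comm, trace_smul, Finset.smul_sum, smul_smul]

variable (ν) in
/-- The real vector space of standard potentials. -/
def standardPotentials : Submodule ℝ (Finset (Site ν) → Op ν) where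
  carrier := {Φ | IsStandardPotential Φ}
  zero_mem' := by
    refine ⟨fun I => zero_mem _, rfl, fun I => star_zero _, fun I => map_zero _, fun I J _ => ?_,
      fun I => ?_⟩
    · simp [condExp, trace]
    · have : partialHamiltonian (0 : Finset (Site ν) → Op ν) I = fun _ => 0 := by
        ext1 J
        simp [partialHamiltonian]
      rw [this]
      exact cauchySeq_const 0
  add_mem' := by
    intro Φ Ψ hΦ hΨ
    refine ⟨fun I => add_mem (hΦ.mem_local I) (hΨ.mem_local I), ?_, fun I => ?_, fun I => ?_,
      fun I J h => ?_, fun I => ?_⟩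
    · simp [hΦ.empty, hΨ.empty]
    · simp [hΦ.selfAdjoint, hΨ.selfAdjoint]
    · simp [hΦ.even, hΨ.even]
    · rw [Pi.add_apply, condExp_add, hΦ.standard I J h, hΨ.standard I J h, add_zero]
    · have : partialHamiltonian (Φ + Ψ) I = partialHamiltonian Φ I + partialHamiltonian Ψ I := by
        ext1 J
        simp only [partialHamiltonian, Pi.add_apply, Finset.sum_add_distrib]
      rw [this]
      exact (hΦ.cauchy I).add (hΨ.cauchy I)
  smul_mem' := by
    intro c Φ hΦ
    refine ⟨fun I => ?_, ?_, fun I => ?_, fun I => ?_, fun I J h => ?_, fun I => ?_⟩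
    · rw [Pi.smul_apply, real_smul_eq]
      exact SMulMemClass.smul_mem _ (hΦ.mem_local I)
    · simp [hΦ.empty]
    · rw [Pi.smul_apply, real_smul_eq, star_smul, hΦ.selfAdjoint]
      simp
    · rw [Pi.smul_apply, real_smul_eq, map_smul, hΦ.even]
    · rw [Pi.smul_apply, condExp_smul, hΦ.standard I J h, smul_zero]
    · have : partialHamiltonian (c • Φ) I = fun J => c • partialHamiltonian Φ I J := by
        ext1 J
        simp only [partialHamiltonian, Pi.smul_apply, Finset.smul_sum]
      rw [this]
      exact (uniformContinuous_const_smul c).comp_cauchySeq (hΦ.cauchy I)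

variable (ν) in
/-- The real vector space `P_τ` of translation covariant standard potentials. -/
def covariantPotentials : Submodule ℝ (Finset (Site ν) → Op ν) where
  carrier := {Φ | Φ ∈ standardPotentials ν ∧ ∀ I k, shift k (Φ I) = Φ (translate I k)}
  zero_mem' := ⟨zero_mem _, fun I k => map_zero _⟩
  add_mem' := by
    rintro Φ Ψ ⟨hΦ, hΦ'⟩ ⟨hΨ, hΨ'⟩
    exact ⟨add_mem hΦ hΨ, fun I k => by simp [hΦ', hΨ']⟩
  smul_mem' := by
    rintro c Φ ⟨hΦ, hΦ'⟩
    refine ⟨Submodule.smul_mem _ c hΦ, fun I k => ?_⟩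
    rw [Pi.smul_apply, Pi.smul_apply, real_smul_eq, real_smul_eq, map_smul, hΦ']

/-- The local Hamiltonian `H(I) = lim_J H_J(I)`. -/
def hamiltonian (Φ : Finset (Site ν) → Op ν) (I : Finset (Site ν)) : Op ν :=
  limUnder atTop (partialHamiltonian Φ I)

/-- The internal energy `U(I) = E_I(H(I))`. -/
def internalEnergy (Φ : Finset (Site ν) → Op ν) (I : Finset (Site ν)) : Op ν :=
  condExp I (hamiltonian Φ I)

/-- The norm `‖H({n})‖`, which for a translation covariant potential does not depend on `n`. -/
def potentialNorm (Φ : Finset (Site ν) → Op ν) : ℝ := ‖hamiltonian Φ {0}‖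

open Classical in
/-- The points of `I` at Euclidean distance at most `r` from the complement of `I` in `ℤ^ν`. -/
def surface (r : ℝ) (I : Finset (Site ν)) : Finset (Site ν) :=
  {n ∈ I | ∃ m ∉ I, √(∑ i, ((m i : ℝ) - (n i : ℝ)) ^ 2) ≤ r}

/-- A net of finite sets, indexed by a directed set, is a van Hove net if its members are eventually
nonempty and their surfaces become negligible. -/
def IsVanHoveNet {A : Type*} [Preorder A] (I : A → Finset (Site ν)) : Prop :=
  (∀ᶠ α in atTop, (I α).Nonempty) ∧
    ∀ r : ℝ, 0 < r → Tendsto (fun α => ((surface r (I α)).card : ℝ) / (I α).card) atTop (𝓝 0)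

/-- `f` has the van Hove limit `L`: it converges to `L` along every van Hove net. -/
def HasVanHoveLimit (f : Finset (Site ν) → ℝ) (L : ℝ) : Prop :=
  ∀ (A : Type w) [Preorder A] [IsDirectedOrder A] [Nonempty A] (I : A → Finset (Site ν)),
    IsVanHoveNet I → Tendsto (fun α => f (I α)) atTop (𝓝 L)

/-- `|I|⁻¹ log τ(e^{-X(I)})`; for self-adjoint `X(I)` the number `τ(e^{-X(I)})` is real and
positive. -/
def logTraceDensity (X : Finset (Site ν) → Op ν) (I : Finset (Site ν)) : ℝ :=
  (1 / (I.card : ℝ)) * Real.log (trace (NormedSpace.exp (-X I))).re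

end Fermion

end

/-! The analysis rests on the Peierls–Bogoliubov inequality `log_trace_exp_ge`, proved inside the
GNS space of the trace. For a self-adjoint B in the span of the monomials, right multiplication
supplies a self-adjoint R that commutes with the Fermion algebra and satisfies RΩ = BΩ, where Ω is
the vacuum (`exists_selfAdjoint_right_operator`). Since A and R commute, τ(e^A) is the expectation
of e^{A-R} in the vector e^{B/2}Ω, on which R acts as B does; now e^x ≥ 1 + x gives the inequality.
Applied in both directions it makes A ↦ log τ(e^A) 1-Lipschitz in norm (`abs_log_trace_exp_sub_le`);
applied with a convex combination as base point it makes this function convex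
(`log_trace_exp_convex`).

Locality enters through the conditional expectations, which are contractions with E_J(H(I)) =
H_J(I). Peeling H_J(D) site by site, each site n contributes a conditional expectation of H({n}), of
norm at most ‖Φ‖. By covariance H({n}) is approximated, uniformly in n, by its truncation to a
translate of one finite window, so a site far from the complement of D hardly notices what lies
outside D. Hence D interacts with its complement only through a surface term plus ε|D|
(`exists_surface_bound`). Even local elements over disjoint regions commute and the trace factorizes
over them, so log τ(e^{-U}) is additive up to that error.

Finally, a set with a small surface is filled by translates of one large cube, apart from sites near
its boundary. Its density log τ(e^{-U(I)})/|I| is therefore close to that of the cube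
(`exists_logPartition_approx`). No monotonicity is needed: the densities of the cubes form a Cauchy
sequence, and their limit p is approximated by every set with a small enough surface. H(I) and U(I)
differ by a surface term. Convexity and the Lipschitz bound hold in each finite volume and survive
the limit along cubes. -/

namespace Fermion

open Filter Topology

variable {ν : ℕ}

/-! ### Right multiplication in the GNS space of the trace -/

section RightMultiplication

/-- Right multiplication by the ordered monomial with label `S`. -/
noncomputable def rightMonomial (S : Finset (Mode ν)) : Op ν :=
  signedPerm (fun T => reorderSign (symmDiff S T) S) (symmDiffPerm S)

/-- This is associativity, (e_S x) e_T = e_S (x e_T): `reorderSign` is multiplicative in each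
argument, so both orders collect the same signs. -/
theorem commute_monomial_rightMonomial (S T : Finset (Mode ν)) :
    Commute (monomial S) (rightMonomial T) := by
  change monomial S * rightMonomial T = rightMonomial T * monomial S
  rw [monomial, rightMonomial, signedPerm_mul, signedPerm_mul]
  congr 1
  · ext R : 1
    simp only [symmDiffPerm, Equiv.coe_fn_mk, reorderSign_symmDiff_left, reorderSign_symmDiff_right]
    ac_rfl
  · ext R : 1
    change symmDiff T (symmDiff S R) = symmDiff S (symmDiff T R)
    exact symmDiff_left_comm _ _ _

theorem star_rightMonomial (S : Finset (Mode ν)) :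
    star (rightMonomial S) = ((reorderSign S S : ℤ) : ℂ) • rightMonomial S := by
  ext f R
  rw [rightMonomial, signedPerm_star, signedPerm_apply]
  change _ = ((reorderSign S S : ℤ) : ℂ) *
    (signedPerm (fun T => reorderSign (symmDiff S T) S) (symmDiffPerm S) f) R
  rw [signedPerm_apply, ← mul_assoc]
  congr 1
  simp only [symmDiffPerm, Equiv.coe_fn_symm_mk, reorderSign_symmDiff_left]
  rcases Int.units_eq_one_or (reorderSign S S) with h1 | h1 <;> simp [h1]

theorem rightMonomial_vacuum (S : Finset (Mode ν)) :
    rightMonomial S vacuum = monomial S vacuum := by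
  ext R
  rw [rightMonomial, monomial, signedPerm_apply, signedPerm_apply]
  change _ * vacuum (symmDiff S R) = _ * vacuum (symmDiff S R)
  by_cases h : symmDiff S R = ∅
  · rw [h]
    simp [reorderSign]
  · rw [vacuum, lp.single_apply_ne _ _ _ h, mul_zero, mul_zero]

theorem mem_carAlgebra_of_mem_monomialSpan {I : Set (Site ν)} {x : Op ν}
    (hx : x ∈ monomialSpan I) : x ∈ carAlgebra ν := by
  induction hx using Submodule.span_induction with
  | mem x h =>
    obtain ⟨S, -, rfl⟩ := h
    exact monomial_mem S fun _ _ => Set.mem_univ _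
  | zero => exact zero_mem _
  | add x y _ _ hx hy => exact add_mem hx hy
  | smul c x _ hx => exact SMulMemClass.smul_mem _ hx

/-- A continuous linear identity on the Fermion algebra may be checked on monomials. -/
theorem carAlgebra_induction {p : Op ν → Prop} (hm : ∀ S, p (monomial S)) (h0 : p 0)
    (ha : ∀ x y, p x → p y → p (x + y)) (hs : ∀ (c : ℂ) x, p x → p (c • x))
    (hc : IsClosed {x | p x}) {x : Op ν} (hx : x ∈ carAlgebra ν) : p x := by
  have h : ∀ x ∈ monomialSpan (ν := ν) Set.univ, p x := by
    intro x hx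
    induction hx using Submodule.span_induction with
    | mem x h =>
      obtain ⟨S, -, rfl⟩ := h
      exact hm S
    | zero => exact h0
    | add x y _ _ hx hy => exact ha _ _ hx hy
    | smul c x _ hx => exact hs _ _ hx
  exact closure_minimal h hc (localAlgebra_subset_closure hx)

/-- Replace every left monomial in x by the right one with the same coefficient. The condition on
`star R` is carried along so that R can later be replaced by its self-adjoint part. -/
theorem exists_right_operator {x : Op ν} (hx : x ∈ monomialSpan (ν := ν) Set.univ) :
    ∃ R : Op ν, R vacuum = x vacuum ∧ star R vacuum = star x vacuum ∧
      ∀ y ∈ carAlgebra ν, Commute y R := by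
  induction hx using Submodule.span_induction with
  | mem x h =>
    obtain ⟨S, -, rfl⟩ := h
    refine ⟨rightMonomial S, rightMonomial_vacuum S, ?_, fun y hy => ?_⟩
    · rw [star_rightMonomial, star_monomial]
      simp [rightMonomial_vacuum]
    · refine carAlgebra_induction (p := fun y => Commute y (rightMonomial S))
        (fun T => commute_monomial_rightMonomial T S) (Commute.zero_left _)
        (fun x y hx hy => hx.add_left hy) (fun c x hx => hx.smul_left c)
        (isClosed_eq (by fun_prop) (by fun_prop)) hy
  | zero => exact ⟨0, rfl, by simp, fun y _ => Commute.zero_right y⟩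
  | add x y _ _ hx hy =>
    obtain ⟨R, h1, h2, h3⟩ := hx
    obtain ⟨R', h1', h2', h3'⟩ := hy
    refine ⟨R + R', ?_, ?_, fun y hy => (h3 y hy).add_right (h3' y hy)⟩
    · simp [h1, h1']
    · rw [star_add, star_add, add_apply, add_apply, h2, h2']
  | smul c x _ hx =>
    obtain ⟨R, h1, h2, h3⟩ := hx
    refine ⟨c • R, ?_, ?_, fun y hy => (h3 y hy).smul_right c⟩
    · simp [h1]
    · rw [star_smul, star_smul, smul_apply, smul_apply, h2]

theorem exists_selfAdjoint_right_operator {x : Op ν} (hx : x ∈ monomialSpan (ν := ν) Set.univ)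
    (hsa : IsSelfAdjoint x) :
    ∃ R : Op ν, IsSelfAdjoint R ∧ R vacuum = x vacuum ∧ ∀ y ∈ carAlgebra ν, Commute y R := by
  obtain ⟨R, h1, h2, h3⟩ := exists_right_operator hx
  refine ⟨(1 / 2 : ℂ) • (R + star R), ?_, ?_, fun y hy => ?_⟩
  · rw [IsSelfAdjoint, star_smul, star_add, star_star, add_comm]
    simp
  · rw [smul_apply, add_apply, h1, h2, hsa.star_eq,
      ← two_smul ℂ (x vacuum), smul_smul]
    simp
  · have h4 := (h3 (star y) (star_mem hy)).star_star
    rw [star_star] at h4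
    exact ((h3 y hy).add_right h4).smul_right _

end RightMultiplication

/-! ### Klein and Peierls–Bogoliubov inequalities for the tracial state -/

section TraceInequalities

open NormedSpace

theorem exp_add_mul {A B : Op ν} (h : Commute A B) : exp (A + B) = exp A * exp B :=
  letI : NormedAlgebra ℚ (Op ν) := NormedAlgebra.restrictScalars ℚ ℂ (Op ν)
  exp_add_of_commute h

/-- The vector `e^{B/2} Ω`, which induces the positive functional `x ↦ τ(e^{B/2} x e^{B/2})`. -/
noncomputable def gibbsVector (B : Op ν) : Hil ν := exp ((1 / 2 : ℂ) • B) vacuum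

theorem isSelfAdjoint_half_smul {B : Op ν} (hB : IsSelfAdjoint B) :
    IsSelfAdjoint ((1 / 2 : ℂ) • B) := by
  rw [IsSelfAdjoint, star_smul, hB.star_eq]
  simp

theorem isSelfAdjoint_ofReal_smul (a : ℝ) {B : Op ν} (hB : IsSelfAdjoint B) :
    IsSelfAdjoint ((a : ℂ) • B) := by
  rw [IsSelfAdjoint, star_smul, hB.star_eq]
  simp

theorem exp_eq_half_mul_half (B : Op ν) :
    exp B = exp ((1 / 2 : ℂ) • B) * exp ((1 / 2 : ℂ) • B) := by
  rw [← exp_add_mul (Commute.refl _), ← add_smul]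
  norm_num

theorem inner_selfAdjoint_left {X : Op ν} (hX : IsSelfAdjoint X) (v w : Hil ν) :
    inner ℂ (X v) w = inner ℂ v (X w) := by
  nth_rewrite 1 [← hX.star_eq]
  exact ContinuousLinearMap.adjoint_inner_left X w v

theorem trace_exp {B : Op ν} (hB : IsSelfAdjoint B) :
    trace (exp B) = ((‖gibbsVector B‖ ^ 2 : ℝ) : ℂ) := by
  rw [trace, exp_eq_half_mul_half, mul_apply_eq_comp,
    ← inner_selfAdjoint_left (isSelfAdjoint_half_smul hB).exp]
  change inner ℂ (gibbsVector B) (gibbsVector B) = _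
  rw [inner_self_eq_norm_sq_to_K]
  push_cast
  rfl

theorem vacuum_ne_zero : (vacuum : Hil ν) ≠ 0 := by
  intro h
  have := trace_one (ν := ν)
  rw [inner_vacuum, one_apply_eq_self, h] at this
  simp at this

theorem gibbsVector_ne_zero (B : Op ν) : gibbsVector B ≠ 0 := by
  intro h
  have h1 : exp (-((1 / 2 : ℂ) • B)) * exp ((1 / 2 : ℂ) • B) = 1 := by
    rw [← exp_add_mul (Commute.refl _).neg_left, neg_add_cancel, exp_zero]
  have h2 := congrArg (fun x : Op ν => x vacuum) h1
  simp only [mul_apply_eq_comp, one_apply_eq_self] at h2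
  change exp (-((1 / 2 : ℂ) • B)) (gibbsVector B) = _ at h2
  rw [h, map_zero] at h2
  exact vacuum_ne_zero h2.symm

/-- Keeps every logarithm below away from the default value of `Real.log` at 0. -/
theorem trace_exp_re_pos {B : Op ν} (hB : IsSelfAdjoint B) : 0 < (trace (exp B)).re := by
  rw [trace_exp hB, Complex.ofReal_re]
  have := norm_pos_iff.mpr (gibbsVector_ne_zero B)
  positivity

/-- `e^X ≥ 1 + X` in quadratic form. -/
theorem inner_exp_ge {H : Type*} [NormedAddCommGroup H] [InnerProductSpace ℂ H] [CompleteSpace H]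
    {X : H →L[ℂ] H} (hX : IsSelfAdjoint X) (w : H) :
    ‖w‖ ^ 2 + (inner ℂ w (X w)).re ≤ (inner ℂ w (exp X w)).re := by
  have h1 : cfc (fun x : ℝ => Real.exp x - (1 + x)) X = exp X - (1 + X) := by
    rw [cfc_sub _ _ X (by fun_prop) (by fun_prop), CFC.real_exp_eq_normedSpace_exp,
      cfc_const_add 1 _ X (by fun_prop), cfc_id' ℝ X]
    simp
  have h2 : 0 ≤ exp X - (1 + X) := by
    rw [← h1]
    exact cfc_nonneg fun x _ => by linarith [Real.add_one_le_exp x]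
  have h3 := ((ContinuousLinearMap.nonneg_iff_isPositive _).mp h2).re_inner_nonneg_right w
  have h4 : (inner ℂ w w).re = ‖w‖ ^ 2 := by
    rw [inner_self_eq_norm_sq_to_K]
    norm_cast
  change 0 ≤ (inner ℂ w ((exp X - (1 + X)) w)).re at h3
  rw [sub_apply, add_apply, one_apply_eq_self, inner_sub_right,
    inner_add_right, Complex.sub_re, Complex.add_re, h4] at h3
  linarith

/-- Power by power: R^{n+1}Ω = R^n BΩ = B R^n Ω = B^{n+1}Ω. -/
theorem exp_vacuum_eq {R B : Op ν} (h : R vacuum = B vacuum) (hc : Commute B R) :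
    exp R vacuum = exp B vacuum := by
  have hp : ∀ n : ℕ, (R ^ n) vacuum = (B ^ n) vacuum := by
    intro n
    induction n with
    | zero => simp
    | succ n ih =>
      rw [pow_succ, mul_apply_eq_comp, h, ← mul_apply_eq_comp,
        ← (hc.pow_right n).eq, mul_apply_eq_comp, ih, ← mul_apply_eq_comp,
        pow_succ']
  have hs : ∀ x : Op ν, HasSum (fun n : ℕ => (n.factorial⁻¹ : ℂ) • (x ^ n) vacuum)
      (exp x vacuum) := fun x =>
    (exp_series_hasSum_exp' (𝕂 := ℂ) x).mapL (ContinuousLinearMap.apply ℂ (Hil ν) vacuum)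
  have h1 := hs R
  simp only [hp] at h1
  exact h1.unique (hs B)

/-- Klein's inequality for the exponential function and the tracial state. -/
theorem trace_exp_ge {A B : Op ν} (hA : IsSelfAdjoint A) (hB : IsSelfAdjoint B)
    (hAm : A ∈ carAlgebra ν) (hBm : B ∈ monomialSpan (ν := ν) Set.univ) :
    ‖gibbsVector B‖ ^ 2 + (inner ℂ (gibbsVector B) ((A - B) (gibbsVector B))).re ≤
      (trace (exp A)).re := by
  obtain ⟨R, hR, hRv, hRc⟩ := exists_selfAdjoint_right_operator hBm hB
  have hBR := hRc B (mem_carAlgebra_of_mem_monomialSpan hBm)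
  have hAR := hRc A hAm
  have hX : IsSelfAdjoint (A - R) := hA.sub hR
  have hXR : Commute (A - R) ((1 / 2 : ℂ) • R) := (hAR.sub_left (Commute.refl R)).smul_right _
  have hw : exp ((1 / 2 : ℂ) • R) vacuum = gibbsVector B :=
    exp_vacuum_eq (by simp [hRv]) ((hBR.smul_left _).smul_right _)
  -- A need not commute with B, but it commutes with R, so the exponential splits exactly.
  have h1 : exp A = exp ((1 / 2 : ℂ) • R) * exp (A - R) * exp ((1 / 2 : ℂ) • R) := by
    rw [(hXR.exp).symm.eq, mul_assoc, ← exp_eq_half_mul_half, ← exp_add_mul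
      (hAR.sub_left (Commute.refl R)), sub_add_cancel]
  have h2 : trace (exp A) = inner ℂ (gibbsVector B) (exp (A - R) (gibbsVector B)) := by
    rw [trace, h1, mul_apply_eq_comp, mul_apply_eq_comp,
      ← inner_selfAdjoint_left (isSelfAdjoint_half_smul hR).exp, hw]
  -- R and B both pass through e^{B/2} to the vacuum, where they agree.
  have h3 : (A - R) (gibbsVector B) = (A - B) (gibbsVector B) := by
    have e1 : R (gibbsVector B) = B (gibbsVector B) := by
      have hBe : Commute (exp ((1 / 2 : ℂ) • B)) R := (hBR.smul_left _).exp_left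
      have hBe' : Commute (exp ((1 / 2 : ℂ) • B)) B := ((Commute.refl B).smul_left _).exp_left
      rw [gibbsVector, ← mul_apply_eq_comp, ← hBe.eq, mul_apply_eq_comp,
        hRv, ← mul_apply_eq_comp, hBe'.eq, mul_apply_eq_comp]
    rw [sub_apply, sub_apply, e1]
  rw [h2, ← h3]
  exact inner_exp_ge hX _

theorem exp_add_smul_one (A : Op ν) (c : ℂ) : exp (A + c • 1) = Complex.exp c • exp A := by
  have h : Commute A (c • (1 : Op ν)) := (Commute.one_right A).smul_right c
  have h1 : exp (c • (1 : Op ν)) = Complex.exp c • 1 := by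
    rw [← Algebra.algebraMap_eq_smul_one, ← Algebra.algebraMap_eq_smul_one, Complex.exp_eq_exp_ℂ,
      algebraMap_exp_comm]
  rw [exp_add_mul h, h1, mul_smul_comm, mul_one]

/-- The Peierls–Bogoliubov inequality. -/
theorem log_trace_exp_ge {A B : Op ν} (hA : IsSelfAdjoint A) (hB : IsSelfAdjoint B)
    (hAm : A ∈ carAlgebra ν) (hBm : B ∈ monomialSpan (ν := ν) Set.univ) :
    Real.log (trace (exp B)).re +
      (inner ℂ (gibbsVector B) ((A - B) (gibbsVector B))).re / ‖gibbsVector B‖ ^ 2 ≤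
      Real.log (trace (exp A)).re := by
  set w := gibbsVector B with hw
  have hw0 : 0 < ‖w‖ ^ 2 := by
    have := norm_pos_iff.mpr (gibbsVector_ne_zero B)
    positivity
  -- Shifting A by -c cancels the linear term in Klein's inequality, leaving ‖w‖² ≤ e^{-c} τ(e^A);
  -- its logarithm is the claim.
  set c : ℝ := (inner ℂ w ((A - B) w)).re / ‖w‖ ^ 2 with hc
  have hcs : IsSelfAdjoint (((-c : ℝ) : ℂ) • (1 : Op ν)) := by
    rw [IsSelfAdjoint, star_smul, star_one]
    simp
  have h := trace_exp_ge (hA.add hcs) hB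
    (add_mem hAm (SMulMemClass.smul_mem _ (one_mem _))) hBm
  rw [← hw, exp_add_smul_one, trace_smul, ← Complex.ofReal_exp, Complex.re_ofReal_mul] at h
  have h1 : (A + ((-c : ℝ) : ℂ) • 1 - B) w = (A - B) w + ((-c : ℝ) : ℂ) • w := by
    simp only [sub_apply, add_apply,
      smul_apply, one_apply_eq_self]
    abel
  have h2 : (inner ℂ w (((-c : ℝ) : ℂ) • w)).re = -c * ‖w‖ ^ 2 := by
    rw [inner_smul_right, Complex.re_ofReal_mul, inner_self_eq_norm_sq_to_K]
    norm_cast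
  have h3 : c * ‖w‖ ^ 2 = (inner ℂ w ((A - B) w)).re := by
    rw [hc, div_mul_cancel₀ _ hw0.ne']
  rw [h1, inner_add_right, Complex.add_re, h2] at h
  have h4 : ‖w‖ ^ 2 ≤ Real.exp (-c) * (trace (exp A)).re := by linarith
  have h5 := Real.log_le_log hw0 h4
  rw [Real.log_mul (Real.exp_ne_zero _) (trace_exp_re_pos hA).ne', Real.log_exp] at h5
  rw [trace_exp hB, Complex.ofReal_re, ← hw]
  linarith

theorem abs_inner_gibbsVector_le (B D : Op ν) :
    |(inner ℂ (gibbsVector B) (D (gibbsVector B))).re / ‖gibbsVector B‖ ^ 2| ≤ ‖D‖ := by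
  have hw0 : 0 < ‖gibbsVector B‖ ^ 2 := by
    have := norm_pos_iff.mpr (gibbsVector_ne_zero B)
    positivity
  rw [abs_div, abs_of_pos hw0, div_le_iff₀ hw0]
  calc _ ≤ ‖inner ℂ (gibbsVector B) (D (gibbsVector B))‖ := Complex.abs_re_le_norm _
    _ ≤ ‖gibbsVector B‖ * ‖D (gibbsVector B)‖ := norm_inner_le_norm _ _
    _ ≤ ‖gibbsVector B‖ * (‖D‖ * ‖gibbsVector B‖) := by gcongr; exact D.le_opNorm _
    _ = _ := by ring

/-- Peierls–Bogoliubov with A and B exchanged bounds both signs. Each of them serves once as base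
point, so both must lie in the span of the monomials. -/
theorem abs_log_trace_exp_sub_le {A B : Op ν} (hA : IsSelfAdjoint A) (hB : IsSelfAdjoint B)
    (hAm : A ∈ monomialSpan (ν := ν) Set.univ) (hBm : B ∈ monomialSpan (ν := ν) Set.univ) :
    |Real.log (trace (exp A)).re - Real.log (trace (exp B)).re| ≤ ‖A - B‖ := by
  have h1 := log_trace_exp_ge hA hB (mem_carAlgebra_of_mem_monomialSpan hAm) hBm
  have h2 := log_trace_exp_ge hB hA (mem_carAlgebra_of_mem_monomialSpan hBm) hAm
  have h3 := abs_le.mp (abs_inner_gibbsVector_le B (A - B))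
  have h4 := abs_le.mp (abs_inner_gibbsVector_le A (B - A))
  rw [norm_sub_rev] at h4
  rw [abs_le]
  constructor <;> linarith [h3.1, h4.1]

/-- Take C = aA + bB as base point: the linear terms of A - C and B - C, weighted by a and b,
cancel. -/
theorem log_trace_exp_convex {A B : Op ν} (hA : IsSelfAdjoint A) (hB : IsSelfAdjoint B)
    (hAm : A ∈ monomialSpan (ν := ν) Set.univ) (hBm : B ∈ monomialSpan (ν := ν) Set.univ)
    {a b : ℝ} (ha : 0 ≤ a) (hb : 0 ≤ b) (hab : a + b = 1) :
    Real.log (trace (exp ((a : ℂ) • A + (b : ℂ) • B))).re ≤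
      a * Real.log (trace (exp A)).re + b * Real.log (trace (exp B)).re := by
  set C := (a : ℂ) • A + (b : ℂ) • B with hC
  have hCs : IsSelfAdjoint C := (isSelfAdjoint_ofReal_smul a hA).add (isSelfAdjoint_ofReal_smul b hB)
  have hCm : C ∈ monomialSpan (ν := ν) Set.univ := by
    exact add_mem (Submodule.smul_mem _ _ hAm) (Submodule.smul_mem _ _ hBm)
  have h1 := log_trace_exp_ge hA hCs (mem_carAlgebra_of_mem_monomialSpan hAm) hCm
  have h2 := log_trace_exp_ge hB hCs (mem_carAlgebra_of_mem_monomialSpan hBm) hCm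
  set w := gibbsVector C
  have h3 : a * (inner ℂ w ((A - C) w)).re + b * (inner ℂ w ((B - C) w)).re = 0 := by
    have e : (a : ℂ) • (A - C) w + (b : ℂ) • (B - C) w = 0 := by
      have hb' : (b : ℂ) = 1 - a := by rw [← Complex.ofReal_one, ← hab]; push_cast; ring
      rw [hC, hb']
      simp only [sub_apply, add_apply,
        smul_apply]
      module
    have e2 := congrArg (fun v => (inner ℂ w v).re) e
    simpa [inner_add_right, inner_smul_right] using e2
  have h4 := add_le_add (mul_le_mul_of_nonneg_left h1 ha) (mul_le_mul_of_nonneg_left h2 hb)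
  have h5 : a * ((inner ℂ w ((A - C) w)).re / ‖w‖ ^ 2) +
      b * ((inner ℂ w ((B - C) w)).re / ‖w‖ ^ 2) = 0 := by
    rw [← mul_div_assoc, ← mul_div_assoc, ← add_div, h3, zero_div]
  have h6 : a * Real.log (trace (exp C)).re + b * Real.log (trace (exp C)).re =
      Real.log (trace (exp C)).re := by rw [← add_mul, hab, one_mul]
  linarith

end TraceInequalities

/-! ### Factorization of the trace and graded commutation over disjoint regions -/

section LocalStructure

theorem monomialSpan_mono {I J : Set (Site ν)} (h : I ⊆ J) : monomialSpan I ≤ monomialSpan J :=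
  Submodule.span_mono (Set.image_mono fun _ hS x hx => h (hS x hx))

theorem trace_mul_of_disjoint {I J : Set (Site ν)} (h : Disjoint I J) {x y : Op ν}
    (hx : x ∈ monomialSpan I) (hy : y ∈ monomialSpan J) :
    trace (x * y) = trace x * trace y := by
  induction hx using Submodule.span_induction with
  | mem x hx =>
    obtain ⟨S, hS, rfl⟩ := hx
    induction hy using Submodule.span_induction with
    | mem y hy =>
      obtain ⟨T, hT, rfl⟩ := hy
      rw [trace_monomial_mul, trace_monomial, trace_monomial]
      by_cases hST : S = T
      · subst hST
        have : S = ∅ := Finset.eq_empty_of_forall_notMem fun z hz =>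
          Set.disjoint_left.mp h (hS z hz) (hT z hz)
        subst this
        simp [reorderSign]
      · rw [if_neg hST]
        by_cases h1 : S = ∅
        · have h2 : T ≠ ∅ := fun h2 => hST (h1.trans h2.symm)
          rw [if_neg h2, mul_zero]
        · rw [if_neg h1, zero_mul]
    | zero => simp [trace]
    | add y z _ _ hy hz => rw [mul_add, trace_add, trace_add, hy, hz, mul_add]
    | smul c y _ hy => rw [mul_smul_comm, trace_smul, trace_smul, hy, mul_left_comm]
  | zero => simp [trace]
  | add x z _ _ hx hz => rw [add_mul, trace_add, trace_add, hx, hz, add_mul]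
  | smul c x _ hx => rw [smul_mul_assoc, trace_smul, trace_smul, hx, mul_assoc]

/-- The automorphism that multiplies the generator with label `x` by the sign `g x`. -/
noncomputable def signAut (g : Mode ν → ℤˣ) : Op ν ≃⋆ₐ[ℂ] Op ν :=
  Unitary.conjStarAlgAut ℂ (Op ν)
    ⟨signedPerm (fun S => ∏ x ∈ S, g x) (Equiv.refl _), signedPerm_mem_unitary _ _⟩

theorem signAut_monomial (g : Mode ν → ℤˣ) (S : Finset (Mode ν)) :
    signAut g (monomial S) = ((∏ x ∈ S, g x : ℤˣ) : ℂ) • monomial S := by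
  change signedPerm _ _ * monomial S * star (signedPerm _ _) = _
  rw [signedPerm_star, monomial, signedPerm_mul, signedPerm_mul]
  ext f T
  rw [signedPerm_apply]
  change _ = ((∏ x ∈ S, g x : ℤˣ) : ℂ) * (signedPerm _ _ f T)
  rw [signedPerm_apply, ← mul_assoc]
  congr 1
  simp only [symmDiffPerm, Equiv.coe_refl, id, Equiv.refl_symm, Equiv.trans_apply, Equiv.coe_fn_mk,
    prod_symmDiff]
  rcases Int.units_eq_one_or (∏ x ∈ S, g x) with h1 | h1 <;>
  rcases Int.units_eq_one_or (∏ x ∈ T, g x) with h2 | h2 <;> simp [h1, h2]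

theorem theta_monomial (S : Finset (Mode ν)) :
    theta ν (monomial S) = (((-1) ^ S.card : ℤˣ) : ℂ) • monomial S := by
  rw [← Finset.prod_const, ← signAut_monomial]
  simp only [theta, parityUnitary, signAut, Finset.prod_const]

theorem norm_starAlgEquiv (f : Op ν ≃⋆ₐ[ℂ] Op ν) (x : Op ν) : ‖f x‖ = ‖x‖ :=
  NonUnitalStarAlgHom.norm_map (f : Op ν →⋆ₐ[ℂ] Op ν) f.injective x

theorem continuous_starAlgEquiv (f : Op ν ≃⋆ₐ[ℂ] Op ν) : Continuous f :=
  (AddMonoidHomClass.isometry_of_norm f (norm_starAlgEquiv f)).continuous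

/-- Exchanging disjoint monomials costs the sign (-1)^{|S||T|}. -/
theorem commute_monomial_of_even {S T : Finset (Mode ν)} (h : Disjoint S T) (hS : Even S.card) :
    Commute (monomial S) (monomial T) := by
  have h1 : reorderSign S T * reorderSign T S = 1 := by
    rw [reorderSign, reorderSign, Finset.prod_comm (s := T), ← Finset.prod_mul_distrib]
    refine (Finset.prod_congr rfl fun x hx => ?_).trans (b := ∏ x ∈ S, (-1) ^ T.card) ?_
    · rw [← Finset.prod_mul_distrib, ← Finset.prod_const]
      refine Finset.prod_congr rfl fun y hy => ?_
      have hxy : x ≠ y := fun e => Finset.disjoint_left.mp h hx (e ▸ hy)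
      have := before_trichotomy hxy
      by_cases h2 : Before y x <;> simp_all [swapSign]
    · rw [Finset.prod_const, ← pow_mul, mul_comm, pow_mul, hS.neg_one_pow, one_pow]
  have h2 : reorderSign S T = reorderSign T S := by
    rw [eq_comm, ← one_mul (reorderSign T S), ← Int.units_mul_self (reorderSign S T), mul_assoc,
      h1, mul_one]
  change monomial S * monomial T = monomial T * monomial S
  rw [monomial_mul, monomial_mul, h2, symmDiff_comm]

/-- Adding Θ(x) to x kills the odd monomials and doubles the even ones; for even x the result is 2x.
-/
theorem commute_of_even {I J : Set (Site ν)} (h : Disjoint I J) {x y : Op ν}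
    (hx : x ∈ monomialSpan I) (he : theta ν x = x) (hy : y ∈ monomialSpan J) : Commute x y := by
  have key : ∀ x ∈ monomialSpan I, Commute (x + theta ν x) y := by
    intro x hx
    induction hx using Submodule.span_induction with
    | mem x hx =>
      obtain ⟨S, hS, rfl⟩ := hx
      rw [theta_monomial]
      rcases Nat.even_or_odd S.card with h1 | h1
      · have hc : Commute (monomial S) y := by
          induction hy using Submodule.span_induction with
          | mem y hy =>
            obtain ⟨T, hT, rfl⟩ := hy
            refine commute_monomial_of_even (Finset.disjoint_left.mpr fun z hz hz' => ?_) h1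
            exact Set.disjoint_left.mp h (hS z hz) (hT z hz')
          | zero => exact Commute.zero_right _
          | add y z _ _ hy hz => exact hy.add_right hz
          | smul c y _ hy => exact hy.smul_right c
        exact hc.add_left (hc.smul_left _)
      · rw [h1.neg_one_pow]
        simp
    | zero => simp
    | add x z _ _ hx hz =>
      rw [map_add, add_add_add_comm]
      exact hx.add_left hz
    | smul c x _ hx =>
      rw [map_smul, ← smul_add]
      exact hx.smul_left c
  have h1 := (key x hx).smul_left (1 / 2 : ℂ)
  rw [he, ← two_smul ℂ x, smul_smul] at h1
  simpa using h1

end LocalStructure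

/-! ### Conditional expectations as commuting contractions -/

section ConditionalExpectation

theorem condExp_complex_smul (I : Finset (Site ν)) (c : ℂ) (x : Op ν) :
    condExp I (c • x) = c • condExp I x := by
  simp only [condExp, mul_smul_comm, trace_smul, Finset.smul_sum, smul_smul]

/-- The conditional expectation as a linear map. -/
noncomputable def condExpLinear (I : Finset (Site ν)) : Op ν →ₗ[ℂ] Op ν where
  toFun := condExp I
  map_add' := condExp_add I
  map_smul' := condExp_complex_smul I

theorem condExp_zero (I : Finset (Site ν)) : condExp I 0 = 0 := map_zero (condExpLinear I)

theorem condExp_sub (I : Finset (Site ν)) (x y : Op ν) :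
    condExp I (x - y) = condExp I x - condExp I y := map_sub (condExpLinear I) x y

theorem condExp_sum {α : Type*} (I : Finset (Site ν)) (s : Finset α) (f : α → Op ν) :
    condExp I (∑ a ∈ s, f a) = ∑ a ∈ s, condExp I (f a) := map_sum (condExpLinear I) f s

theorem continuous_condExp (I : Finset (Site ν)) : Continuous (condExp I) := by
  unfold condExp
  refine continuous_finsetSum _ fun S _ => ?_
  exact (continuous_trace.comp (continuous_const.mul continuous_id)).smul continuous_const

open Classical in
theorem condExp_monomial (I : Finset (Site ν)) (S : Finset (Mode ν)) :
    condExp I (monomial S) = if ∀ x ∈ S, x.1 ∈ I then monomial S else 0 := by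
  have h1 : ∀ T, trace (star (monomial T) * monomial S) = if T = S then 1 else 0 := by
    intro T
    rw [star_monomial, smul_mul_assoc, trace_smul, trace_monomial_mul]
    split_ifs with h
    · rcases Int.units_eq_one_or (reorderSign T T) with h | h <;> simp [h]
    · simp
  simp only [condExp, h1, ite_smul, one_smul, zero_smul]
  rw [Finset.sum_ite_eq']
  refine if_congr ?_ rfl rfl
  rw [Finset.mem_powerset]
  exact ⟨fun h x hx => (Finset.mem_product.mp (h hx)).1,
    fun h x hx => Finset.mem_product.mpr ⟨h x hx, Finset.mem_univ _⟩⟩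

theorem condExp_mem_monomialSpan (I : Finset (Site ν)) (x : Op ν) :
    condExp I x ∈ monomialSpan (I : Set (Site ν)) :=
  Submodule.sum_mem _ fun S hS => Submodule.smul_mem _ _ (Submodule.subset_span
    ⟨S, fun _ hy => (Finset.mem_product.mp (Finset.mem_powerset.mp hS hy)).1, rfl⟩)

theorem condExp_of_mem {I : Finset (Site ν)} {x : Op ν}
    (hx : x ∈ localAlgebra (I : Set (Site ν))) : condExp I x = x := by
  have h1 : ∀ x ∈ monomialSpan (I : Set (Site ν)), condExp I x = x := by
    intro x hx
    induction hx using Submodule.span_induction with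
    | mem x h =>
      obtain ⟨S, hS, rfl⟩ := h
      rw [condExp_monomial, if_pos fun x hx => Finset.mem_coe.mp (hS x hx)]
    | zero => exact condExp_zero I
    | add x y _ _ hx hy => rw [condExp_add, hx, hy]
    | smul c x _ hx => rw [condExp_complex_smul, hx]
  exact closure_minimal h1 (isClosed_eq (continuous_condExp I) continuous_id)
    (localAlgebra_subset_closure hx)

/-- For finite I the norm closure adds nothing, because E_I fixes the local algebra and has values
in the span. -/
theorem mem_monomialSpan_of_mem_localAlgebra {I : Finset (Site ν)} {x : Op ν}
    (hx : x ∈ localAlgebra (I : Set (Site ν))) : x ∈ monomialSpan (I : Set (Site ν)) := by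
  rw [← condExp_of_mem hx]
  exact condExp_mem_monomialSpan I x

theorem condExp_condExp (J I : Finset (Site ν)) {x : Op ν} (hx : x ∈ carAlgebra ν) :
    condExp J (condExp I x) = condExp (J ∩ I) x := by
  refine carAlgebra_induction (p := fun x => condExp J (condExp I x) = condExp (J ∩ I) x)
    (fun S => ?_) ?_ (fun x y hx hy => ?_) (fun c x hx => ?_)
    (isClosed_eq ((continuous_condExp J).comp (continuous_condExp I)) (continuous_condExp _)) hx
  · rw [condExp_monomial, condExp_monomial]
    split_ifs with h1 h2 h2
    · rw [condExp_monomial, if_pos fun x hx => (Finset.mem_inter.mp (h2 x hx)).1]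
    · rw [condExp_monomial, if_neg fun h => h2 fun x hx => Finset.mem_inter.mpr ⟨h x hx, h1 x hx⟩]
    · exact absurd (fun x hx => (Finset.mem_inter.mp (h2 x hx)).2) h1
    · exact condExp_zero J
  · simp only [condExp_zero]
  · simp only [condExp_add, hx, hy]
  · simp only [condExp_complex_smul, hx]

open Classical in
/-- Averaging over the sign changes of the generators with labels in `s` removes the monomials that
contain one of them. -/
theorem exists_contraction_removing (s : Finset (Mode ν)) :
    ∃ F : Op ν →ₗ[ℂ] Op ν, (∀ x, ‖F x‖ ≤ ‖x‖) ∧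
      ∀ S, F (monomial S) = if Disjoint S s then monomial S else 0 := by
  induction s using Finset.induction_on with
  | empty => exact ⟨LinearMap.id, fun x => le_rfl, fun S => by simp⟩
  | insert a s ha ih =>
    obtain ⟨F, h1, h2⟩ := ih
    let σ : Op ν ≃⋆ₐ[ℂ] Op ν := signAut fun x => if x = a then -1 else 1
    let σ' : Op ν →ₗ[ℂ] Op ν := (σ : Op ν →⋆ₐ[ℂ] Op ν).toAlgHom.toLinearMap
    refine ⟨(1 / 2 : ℂ) • (F + F ∘ₗ σ'), fun x => ?_, fun S => ?_⟩
    · calc ‖(1 / 2 : ℂ) • (F x + F (σ x))‖ ≤ ‖(1 / 2 : ℂ)‖ * (‖F x‖ + ‖F (σ x)‖) := by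
            rw [norm_smul]; gcongr; exact norm_add_le _ _
        _ ≤ ‖(1 / 2 : ℂ)‖ * (‖x‖ + ‖x‖) := by
            gcongr
            · exact h1 x
            · exact (h1 _).trans (norm_starAlgEquiv σ x).le
        _ = ‖x‖ := by norm_num; ring
    · have h3 : σ (monomial S) = (if a ∈ S then (-1 : ℂ) else 1) • monomial S := by
        rw [signAut_monomial, Finset.prod_ite_eq']
        split_ifs <;> simp
      change (1 / 2 : ℂ) • (F (monomial S) + F (σ (monomial S))) = _
      rw [h3, map_smul, h2]
      by_cases haS : a ∈ S
      · split_ifs <;> simp_all [Finset.disjoint_insert_right]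
      · simp only [haS, if_false, one_smul, Finset.disjoint_insert_right, not_false_eq_true,
          true_and]
        rw [← two_smul ℂ, smul_smul]
        simp

theorem exists_finset_mem_monomialSpan {x : Op ν} (hx : x ∈ monomialSpan (ν := ν) Set.univ) :
    ∃ J : Finset (Site ν), x ∈ monomialSpan (J : Set (Site ν)) := by
  induction hx using Submodule.span_induction with
  | mem x h =>
    obtain ⟨S, -, rfl⟩ := h
    exact ⟨S.image Prod.fst, Submodule.subset_span
      ⟨S, fun x hx => Finset.mem_coe.mpr (Finset.mem_image_of_mem _ hx), rfl⟩⟩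
  | zero => exact ⟨∅, zero_mem _⟩
  | add x y _ _ hx hy =>
    obtain ⟨J, hJ⟩ := hx
    obtain ⟨K, hK⟩ := hy
    exact ⟨J ∪ K, add_mem (monomialSpan_mono (by simp) hJ) (monomialSpan_mono (by simp) hK)⟩
  | smul c x _ hx =>
    obtain ⟨J, hJ⟩ := hx
    exact ⟨J, Submodule.smul_mem _ _ hJ⟩

/-- For x located in a finite J, E_I removes the monomials that involve J \ I, so it agrees with an
average of automorphisms; density covers the rest. -/
theorem norm_condExp_le (I : Finset (Site ν)) {x : Op ν} (hx : x ∈ carAlgebra ν) :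
    ‖condExp I x‖ ≤ ‖x‖ := by
  have h1 : ∀ x ∈ monomialSpan (ν := ν) Set.univ, ‖condExp I x‖ ≤ ‖x‖ := by
    intro x hx
    obtain ⟨J, hJ⟩ := exists_finset_mem_monomialSpan hx
    obtain ⟨F, hF, hFm⟩ := exists_contraction_removing
      ((J \ I) ×ˢ (Finset.univ : Finset Bool))
    have h2 : condExp I x = F x := by
      clear hx
      induction hJ using Submodule.span_induction with
      | mem x h =>
        obtain ⟨S, hS, rfl⟩ := h
        rw [condExp_monomial, hFm]
        refine if_congr ?_ rfl rfl
        rw [Finset.disjoint_left]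
        refine forall₂_congr fun a ha => ?_
        have := Finset.mem_coe.mp (hS a ha)
        simp [this]
      | zero => rw [condExp_zero, map_zero]
      | add x y _ _ hx hy => rw [condExp_add, map_add, hx, hy]
      | smul c x _ hx => rw [condExp_complex_smul, map_smul, hx]
    rw [h2]
    exact hF x
  exact closure_minimal h1 (isClosed_le (continuous_condExp I).norm continuous_norm)
    (localAlgebra_subset_closure hx)

end ConditionalExpectation

/-! ### Finite-volume Hamiltonians and their site-by-site decomposition -/

section LocalHamiltonians

variable {Φ : Finset (Site ν) → Op ν}

theorem IsStandardPotential.condExp_eq (hΦ : IsStandardPotential Φ) (J K : Finset (Site ν)) :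
    condExp J (Φ K) = if K ⊆ J then Φ K else 0 := by
  split_ifs with h
  · exact condExp_of_mem (localAlgebra_mono (Finset.coe_subset.mpr h) (hΦ.mem_local K))
  · rw [← condExp_of_mem (hΦ.mem_local K), condExp_condExp _ _
      (localAlgebra_mono (Set.subset_univ _) (hΦ.mem_local K))]
    -- Standardness speaks only of proper subsets of K, so J is first cut down to J ∩ K.
    refine hΦ.standard _ _ (Finset.inter_subset_right.ssubset_of_ne fun e => h ?_)
    exact Finset.inter_eq_right.mp e

theorem IsStandardPotential.condExp_partialHamiltonian (hΦ : IsStandardPotential Φ)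
    (I J J' : Finset (Site ν)) :
    condExp J (partialHamiltonian Φ I J') = partialHamiltonian Φ I (J ∩ J') := by
  simp only [partialHamiltonian, condExp_sum, hΦ.condExp_eq]
  rw [← Finset.sum_filter]
  refine Finset.sum_congr ?_ fun _ _ => rfl
  ext K
  simp only [Finset.mem_filter, Finset.mem_powerset, Finset.subset_inter_iff]
  tauto

/-- The sets that meet D ∪ I either meet D, or avoid D and meet I. This is the identity behind every
peeling argument below. -/
theorem partialHamiltonian_union (Φ : Finset (Site ν) → Op ν) (D I J : Finset (Site ν)) :
    partialHamiltonian Φ (D ∪ I) J =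
      partialHamiltonian Φ D J + partialHamiltonian Φ I (J \ D) := by
  rw [partialHamiltonian, partialHamiltonian, partialHamiltonian, ← Finset.sum_union]
  · refine Finset.sum_congr ?_ fun _ _ => rfl
    ext K
    simp only [Finset.mem_filter, Finset.mem_powerset, Finset.mem_union, Finset.inter_union_distrib_left,
      Finset.union_nonempty, Finset.subset_sdiff, Finset.disjoint_iff_inter_eq_empty,
      ← Finset.not_nonempty_iff_eq_empty]
    tauto
  · rw [Finset.disjoint_left]
    intro K h1 h2
    simp only [Finset.mem_filter, Finset.mem_powerset, Finset.subset_sdiff,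
      Finset.disjoint_iff_inter_eq_empty] at h1 h2
    rw [h2.1.2] at h1
    exact Finset.not_nonempty_empty h1.2

theorem IsStandardPotential.partialHamiltonian_mem (hΦ : IsStandardPotential Φ)
    (I J : Finset (Site ν)) : partialHamiltonian Φ I J ∈ monomialSpan (J : Set (Site ν)) := by
  refine Submodule.sum_mem _ fun K hK => ?_
  refine monomialSpan_mono (Finset.coe_subset.mpr ?_)
    (mem_monomialSpan_of_mem_localAlgebra (hΦ.mem_local K))
  exact Finset.mem_powerset.mp (Finset.mem_filter.mp hK).1

theorem IsStandardPotential.partialHamiltonian_mem_univ (hΦ : IsStandardPotential Φ)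
    (I J : Finset (Site ν)) : partialHamiltonian Φ I J ∈ monomialSpan (ν := ν) Set.univ :=
  monomialSpan_mono (Set.subset_univ _) (hΦ.partialHamiltonian_mem I J)

theorem IsStandardPotential.isSelfAdjoint_partialHamiltonian (hΦ : IsStandardPotential Φ)
    (I J : Finset (Site ν)) : IsSelfAdjoint (partialHamiltonian Φ I J) := by
  rw [IsSelfAdjoint, partialHamiltonian, star_sum]
  simp only [hΦ.selfAdjoint]

theorem IsStandardPotential.theta_partialHamiltonian (hΦ : IsStandardPotential Φ)
    (I J : Finset (Site ν)) : theta ν (partialHamiltonian Φ I J) = partialHamiltonian Φ I J := by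
  rw [partialHamiltonian, map_sum]
  simp only [hΦ.even]

theorem IsStandardPotential.tendsto_hamiltonian (hΦ : IsStandardPotential Φ)
    (I : Finset (Site ν)) :
    Tendsto (partialHamiltonian Φ I) atTop (𝓝 (hamiltonian Φ I)) :=
  (hΦ.cauchy I).tendsto_limUnder

theorem IsStandardPotential.isSelfAdjoint_hamiltonian (hΦ : IsStandardPotential Φ)
    (I : Finset (Site ν)) : IsSelfAdjoint (hamiltonian Φ I) := by
  have h := (hΦ.tendsto_hamiltonian I).star
  refine tendsto_nhds_unique (h.congr fun J => ?_) (hΦ.tendsto_hamiltonian I)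
  exact hΦ.isSelfAdjoint_partialHamiltonian I J

theorem IsStandardPotential.hamiltonian_mem (hΦ : IsStandardPotential Φ)
    (I : Finset (Site ν)) : hamiltonian Φ I ∈ carAlgebra ν := by
  have hc : IsClosed (carAlgebra ν : Set (Op ν)) :=
    StarSubalgebra.isClosed_topologicalClosure _
  exact hc.mem_of_tendsto (hΦ.tendsto_hamiltonian I) (Eventually.of_forall fun J =>
    mem_carAlgebra_of_mem_monomialSpan (hΦ.partialHamiltonian_mem I J))

/-- E_J sends H_{J'}(I) to H_{J ∩ J'}(I), which is constant once J ⊆ J'. Norm bounds on H(I) thus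
pass to all its truncations. -/
theorem IsStandardPotential.condExp_hamiltonian (hΦ : IsStandardPotential Φ)
    (I J : Finset (Site ν)) : condExp J (hamiltonian Φ I) = partialHamiltonian Φ I J := by
  have h := ((continuous_condExp J).tendsto _).comp (hΦ.tendsto_hamiltonian I)
  refine tendsto_nhds_unique h (tendsto_const_nhds.congr' ?_)
  filter_upwards [eventually_ge_atTop J] with J' hJ'
  rw [Function.comp_apply, hΦ.condExp_partialHamiltonian, Finset.inter_eq_left.mpr hJ']

theorem IsStandardPotential.internalEnergy_eq (hΦ : IsStandardPotential Φ)
    (I : Finset (Site ν)) : internalEnergy Φ I = partialHamiltonian Φ I I :=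
  hΦ.condExp_hamiltonian I I

theorem IsStandardPotential.norm_partialHamiltonian_le (hΦ : IsStandardPotential Φ) {M : ℝ}
    (hM : ∀ n, ‖hamiltonian Φ {n}‖ ≤ M) (I J : Finset (Site ν)) :
    ‖partialHamiltonian Φ I J‖ ≤ I.card * M := by
  induction I using Finset.induction_on generalizing J with
  | empty => simp [partialHamiltonian]
  | insert n I hn ih =>
    rw [Finset.insert_eq, partialHamiltonian_union, ← Finset.insert_eq,
      Finset.card_insert_of_notMem hn, Nat.cast_add_one, add_one_mul, add_comm _ M]
    refine (norm_add_le _ _).trans (add_le_add ?_ (ih _))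
    rw [← hΦ.condExp_hamiltonian]
    exact (norm_condExp_le J (hΦ.hamiltonian_mem _)).trans (hM n)

/-- Changing the volume `J` affects `H_J(D)` only through the sites of `D` whose neighbourhood `B n`
sees the change, up to the error made when `H({n})` is cut off to `B n`. -/
theorem IsStandardPotential.norm_partialHamiltonian_sub_le (hΦ : IsStandardPotential Φ) {M ε : ℝ}
    (hM : ∀ n, ‖hamiltonian Φ {n}‖ ≤ M) (B : Site ν → Finset (Site ν))
    (hB : ∀ n, ‖hamiltonian Φ {n} - partialHamiltonian Φ {n} (B n)‖ ≤ ε) (g : Site ν → ℝ)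
    (D J J' : Finset (Site ν))
    (hg : ∀ n ∈ D, 2 * M ≤ g n ∨ (2 * ε ≤ g n ∧ J ∩ B n = J' ∩ B n)) :
    ‖partialHamiltonian Φ D J - partialHamiltonian Φ D J'‖ ≤ ∑ n ∈ D, g n := by
  induction D using Finset.induction_on generalizing J J' with
  | empty => simp [partialHamiltonian]
  | insert n D hn ih =>
    rw [Finset.insert_eq, partialHamiltonian_union, partialHamiltonian_union, ← Finset.insert_eq,
      Finset.sum_insert hn, add_sub_add_comm]
    refine (norm_add_le _ _).trans (add_le_add ?_ (ih _ _ fun m hm => ?_))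
    · rcases hg n (Finset.mem_insert_self n D) with h | ⟨h, hJ⟩
      · have h1 := fun J => (norm_condExp_le J (hΦ.hamiltonian_mem {n})).trans (hM n)
        rw [← hΦ.condExp_hamiltonian, ← hΦ.condExp_hamiltonian]
        linarith [norm_sub_le (condExp J (hamiltonian Φ {n})) (condExp J' (hamiltonian Φ {n})),
          h1 J, h1 J']
      -- E_J turns the truncation error of H({n}) into H_J - H_{J ∩ B n}. The term H_{J ∩ B n} is
      -- common to J and J', so only two errors of size ε remain.
      · have h1 := fun J => (norm_condExp_le J (sub_mem (hΦ.hamiltonian_mem {n})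
          (mem_carAlgebra_of_mem_monomialSpan (hΦ.partialHamiltonian_mem {n} (B n))))).trans (hB n)
        simp only [condExp_sub, hΦ.condExp_hamiltonian, hΦ.condExp_partialHamiltonian] at h1
        have h2 := h1 J
        have h3 := h1 J'
        rw [← hJ] at h3
        have h4 := norm_sub_le
          (partialHamiltonian Φ {n} J - partialHamiltonian Φ {n} (J ∩ B n))
          (partialHamiltonian Φ {n} J' - partialHamiltonian Φ {n} (J ∩ B n))
        rw [sub_sub_sub_cancel_right] at h4
        linarith
    · refine (hg m (Finset.mem_insert_of_mem hm)).imp_right fun ⟨h1, h2⟩ => ⟨h1, ?_⟩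
      -- Removing n from both volumes does not disturb their agreement on `B m`.
      rw [Finset.sdiff_inter_right_comm, Finset.sdiff_inter_right_comm, h2]

end LocalHamiltonians

/-! ### Translation covariance -/

section Translations

theorem translate_singleton (n k : Site ν) : translate {n} k = {n + k} := Finset.map_singleton _ _

theorem mem_translate {I : Finset (Site ν)} {k x : Site ν} : x ∈ translate I k ↔ x - k ∈ I := by
  rw [translate, Finset.mem_map]
  constructor
  · rintro ⟨y, hy, rfl⟩
    simpa using hy
  · exact fun h => ⟨x - k, h, by simp⟩

theorem translate_translate_neg (I : Finset (Site ν)) (k : Site ν) :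
    translate (translate I (-k)) k = I := by
  ext x
  simp [mem_translate]

theorem translate_subset_translate {I J : Finset (Site ν)} (k : Site ν) :
    translate I k ⊆ translate J k ↔ I ⊆ J := Finset.map_subset_map

theorem tendsto_translate (k : Site ν) : Tendsto (fun J => translate J k) atTop atTop := by
  refine tendsto_atTop.mpr fun J => ?_
  filter_upwards [eventually_ge_atTop (translate J (-k))] with J' hJ'
  have := (translate_subset_translate k).mpr hJ'
  rwa [translate_translate_neg] at this

theorem trace_shift (k : Site ν) {x : Op ν} (hx : x ∈ carAlgebra ν) :
    trace (shift k x) = trace x := by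
  refine carAlgebra_induction (p := fun x => trace (shift k x) = trace x) (fun S => ?_) ?_
    (fun x y hx hy => ?_) (fun c x hx => ?_)
    (isClosed_eq (continuous_trace.comp (continuous_starAlgEquiv _)) continuous_trace) hx
  · rw [shift_monomial, trace_monomial, trace_monomial]
    simp
  · simp
  · rw [map_add, trace_add, trace_add, hx, hy]
  · rw [map_smul, trace_smul, trace_smul, hx]

theorem exp_mem_localAlgebra {x : Op ν} (I : Set (Site ν)) (hx : x ∈ localAlgebra I) :
    NormedSpace.exp x ∈ localAlgebra I := by
  have hc : IsClosed (localAlgebra I : Set (Op ν)) :=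
    StarSubalgebra.isClosed_topologicalClosure _
  refine hc.mem_of_tendsto (NormedSpace.exp_series_hasSum_exp' (𝕂 := ℂ) x)
    (Eventually.of_forall fun s => ?_)
  exact sum_mem fun n _ => SMulMemClass.smul_mem _ (pow_mem hx n)

theorem continuous_exp : Continuous (NormedSpace.exp : Op ν → Op ν) :=
  letI : NormedAlgebra ℚ (Op ν) := NormedAlgebra.restrictScalars ℚ ℂ (Op ν)
  NormedSpace.exp_continuous

theorem shift_exp (k : Site ν) (x : Op ν) :
    shift k (NormedSpace.exp x) = NormedSpace.exp (shift k x) := by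
  let : NormedAlgebra ℚ (Op ν) := NormedAlgebra.restrictScalars ℚ ℂ (Op ν)
  exact NormedSpace.map_exp _ (continuous_starAlgEquiv (shift k)) x

variable {Φ : Finset (Site ν) → Op ν}

theorem shift_partialHamiltonian (hc : ∀ I k, shift k (Φ I) = Φ (translate I k))
    (I J : Finset (Site ν)) (k : Site ν) :
    shift k (partialHamiltonian Φ I J) =
      partialHamiltonian Φ (translate I k) (translate J k) := by
  rw [partialHamiltonian, partialHamiltonian, map_sum]
  refine Finset.sum_equiv (Equiv.addRight k).finsetCongr (fun K => ?_) fun K _ => hc K k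
  rw [Finset.mem_filter, Finset.mem_filter, Finset.mem_powerset, Finset.mem_powerset]
  change _ ↔ translate K k ⊆ translate J k ∧ (translate K k ∩ translate I k).Nonempty
  rw [translate_subset_translate, translate, translate, ← Finset.map_inter, Finset.map_nonempty]

theorem IsStandardPotential.shift_hamiltonian (hΦ : IsStandardPotential Φ)
    (hc : ∀ I k, shift k (Φ I) = Φ (translate I k)) (I : Finset (Site ν)) (k : Site ν) :
    shift k (hamiltonian Φ I) = hamiltonian Φ (translate I k) := by
  have h1 := ((continuous_starAlgEquiv (shift k)).tendsto _).comp (hΦ.tendsto_hamiltonian I)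
  have h2 := (hΦ.tendsto_hamiltonian (translate I k)).comp (tendsto_translate k)
  refine tendsto_nhds_unique h1 (h2.congr fun J => ?_)
  exact (shift_partialHamiltonian hc I J k).symm

theorem IsStandardPotential.norm_hamiltonian_singleton (hΦ : IsStandardPotential Φ)
    (hc : ∀ I k, shift k (Φ I) = Φ (translate I k)) (n : Site ν) :
    ‖hamiltonian Φ {n}‖ = potentialNorm Φ := by
  rw [potentialNorm, ← norm_starAlgEquiv (shift n) (hamiltonian Φ {0}), hΦ.shift_hamiltonian hc,
    translate_singleton, zero_add]

end Translations

/-! ### Interaction across the boundary as a surface term -/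

section Surface

open Classical in
theorem mem_of_notMem_surface {r : ℝ} {D : Finset (Site ν)} {n m : Site ν} (hn : n ∈ D)
    (hs : n ∉ surface r D) (h : √(∑ i, ((m i : ℝ) - (n i : ℝ)) ^ 2) ≤ r) : m ∈ D := by
  by_contra hm
  exact hs (Finset.mem_filter.mpr ⟨hn, m, hm, h⟩)

open Classical in
theorem surface_subset (r : ℝ) (D : Finset (Site ν)) : surface r D ⊆ D := Finset.filter_subset _ _

variable {Φ : Finset (Site ν) → Op ν}

/-- The interaction of `D` with its complement is a surface term. -/
theorem IsStandardPotential.exists_surface_bound (hΦ : IsStandardPotential Φ)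
    (hc : ∀ I k, shift k (Φ I) = Φ (translate I k)) {ε : ℝ} (hε : 0 < ε) :
    ∃ r : ℝ, 0 < r ∧ ∀ D J : Finset (Site ν), D ⊆ J →
      ‖partialHamiltonian Φ D J - partialHamiltonian Φ D D‖ ≤
        2 * potentialNorm Φ * (surface r D).card + ε * D.card := by
  classical
  -- One window at the origin, accurate to ε/2, serves all sites by translation.
  obtain ⟨B, hB⟩ := ((hΦ.tendsto_hamiltonian {0}).eventually
    (Metric.ball_mem_nhds _ (half_pos hε))).exists
  have hM : 0 ≤ potentialNorm Φ := norm_nonneg _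
  have hB' : ∀ n, ‖hamiltonian Φ {n} - partialHamiltonian Φ {n} (translate B n)‖ ≤ ε / 2 := by
    intro n
    have e : ({n} : Finset (Site ν)) = translate {0} n := by rw [translate_singleton, zero_add]
    rw [e, ← hΦ.shift_hamiltonian hc, ← shift_partialHamiltonian hc, ← map_sub,
      norm_starAlgEquiv, ← dist_eq_norm, dist_comm]
    exact (Metric.mem_ball.mp hB).le
  obtain ⟨r, hr⟩ : ∃ r : ℝ, ∀ m ∈ B, √(∑ i, ((m i : ℝ)) ^ 2) ≤ r := by
    obtain ⟨r, hr⟩ := (B.image fun m => √(∑ i, ((m i : ℝ)) ^ 2)).bddAbove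
    exact ⟨r, fun m hm => hr (Finset.mem_coe.mpr (Finset.mem_image_of_mem _ hm))⟩
  -- The maximum with 1 only secures positivity.
  refine ⟨max r 1, by positivity, fun D J hDJ => ?_⟩
  have h := hΦ.norm_partialHamiltonian_sub_le
    (fun n => (hΦ.norm_hamiltonian_singleton hc n).le) (translate B) hB'
    (fun n => (if n ∈ surface (max r 1) D then 2 * potentialNorm Φ else 0) + ε) D J D
    fun n hn => ?_
  · refine h.trans (le_of_eq ?_)
    rw [Finset.sum_add_distrib, ← Finset.sum_filter, Finset.filter_mem_eq_inter,
      Finset.inter_eq_right.mpr (surface_subset _ D), Finset.sum_const, Finset.sum_const,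
      nsmul_eq_mul, nsmul_eq_mul]
    ring
  · by_cases hs : n ∈ surface (max r 1) D
    · left
      rw [if_pos hs]
      linarith
    · right
      rw [if_neg hs]
      refine ⟨by linarith, ?_⟩
      have hsub : translate B n ⊆ D := by
        intro m hm
        refine mem_of_notMem_surface hn hs (le_trans ?_ (le_max_left r 1))
        have := hr _ (mem_translate.mp hm)
        simpa using this
      rw [Finset.inter_eq_right.mpr hsub, Finset.inter_eq_right.mpr (hsub.trans hDJ)]

/-- H(D) need not lie in the span of the monomials, so the Lipschitz bound is applied to H_J(D) and
J is sent to infinity. -/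
theorem IsStandardPotential.abs_log_trace_exp_hamiltonian_sub_le (hΦ : IsStandardPotential Φ)
    {D : Finset (Site ν)} {b : ℝ} (hb : ∀ J, D ⊆ J →
      ‖partialHamiltonian Φ D J - partialHamiltonian Φ D D‖ ≤ b) :
    |Real.log (trace (NormedSpace.exp (-hamiltonian Φ D))).re -
      Real.log (trace (NormedSpace.exp (-partialHamiltonian Φ D D))).re| ≤ b := by
  have h1 : Tendsto (fun J => (trace (NormedSpace.exp (-partialHamiltonian Φ D J))).re) atTop
      (𝓝 (trace (NormedSpace.exp (-hamiltonian Φ D))).re) :=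
    ((Complex.continuous_re.comp (continuous_trace.comp continuous_exp)).tendsto _).comp
      (hΦ.tendsto_hamiltonian D).neg
  have h2 := ((h1.log (trace_exp_re_pos (hΦ.isSelfAdjoint_hamiltonian D).neg).ne').sub_const
    (Real.log (trace (NormedSpace.exp (-partialHamiltonian Φ D D))).re)).abs
  refine le_of_tendsto h2 ?_
  filter_upwards [eventually_ge_atTop D] with J hJ
  refine (abs_log_trace_exp_sub_le (hΦ.isSelfAdjoint_partialHamiltonian D J).neg
    (hΦ.isSelfAdjoint_partialHamiltonian D D).neg (neg_mem (hΦ.partialHamiltonian_mem_univ D J))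
    (neg_mem (hΦ.partialHamiltonian_mem_univ D D))).trans ?_
  rw [neg_sub_neg, norm_sub_rev]
  exact hb J hJ

end Surface

/-! ### Finite-volume estimates for log τ(e^{-U(I)}) -/

section LogPartition

/-- `log τ(e^{-U(I)})`. -/
noncomputable def logPartition (Φ : Finset (Site ν) → Op ν) (I : Finset (Site ν)) : ℝ :=
  Real.log (trace (NormedSpace.exp (-partialHamiltonian Φ I I))).re

variable {Φ : Finset (Site ν) → Op ν}

theorem IsStandardPotential.logPartition_translate (hΦ : IsStandardPotential Φ)
    (hc : ∀ I k, shift k (Φ I) = Φ (translate I k)) (I : Finset (Site ν)) (k : Site ν) :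
    logPartition Φ (translate I k) = logPartition Φ I := by
  rw [logPartition, logPartition, ← shift_partialHamiltonian hc, ← map_neg, ← shift_exp, trace_shift]
  exact exp_mem_localAlgebra _ (neg_mem
    (mem_carAlgebra_of_mem_monomialSpan (hΦ.partialHamiltonian_mem_univ I I)))

theorem exp_mem_monomialSpan {I : Finset (Site ν)} {x : Op ν}
    (hx : x ∈ monomialSpan (I : Set (Site ν))) :
    NormedSpace.exp x ∈ monomialSpan (I : Set (Site ν)) := by
  have h : x ∈ localAlgebra (I : Set (Site ν)) := by
    induction hx using Submodule.span_induction with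
    | mem x h =>
      obtain ⟨S, hS, rfl⟩ := h
      exact monomial_mem S hS
    | zero => exact zero_mem _
    | add x y _ _ hx hy => exact add_mem hx hy
    | smul c x _ hx => exact SMulMemClass.smul_mem _ hx
  exact mem_monomialSpan_of_mem_localAlgebra (exp_mem_localAlgebra _ h)

theorem log_trace_exp_add {D I : Finset (Site ν)} (h : Disjoint D I) {x y : Op ν}
    (hx : x ∈ monomialSpan (D : Set (Site ν))) (hy : y ∈ monomialSpan (I : Set (Site ν)))
    (hxs : IsSelfAdjoint x) (hys : IsSelfAdjoint y) (he : theta ν x = x) :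
    Real.log (trace (NormedSpace.exp (x + y))).re =
      Real.log (trace (NormedSpace.exp x)).re + Real.log (trace (NormedSpace.exp y)).re := by
  have hd : Disjoint (D : Set (Site ν)) (I : Set (Site ν)) := Finset.disjoint_coe.mpr h
  rw [← Real.log_mul (trace_exp_re_pos hxs).ne' (trace_exp_re_pos hys).ne',
    exp_add_mul (commute_of_even hd hx he hy),
    trace_mul_of_disjoint hd (exp_mem_monomialSpan hx) (exp_mem_monomialSpan hy), trace_exp hxs,
    trace_exp hys, ← Complex.ofReal_mul, Complex.ofReal_re, Complex.ofReal_re, Complex.ofReal_re]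

/-- U(D ∪ I) = H_{D ∪ I}(D) + U(I). Replacing the first term by U(D) decouples the two regions, and
the Lipschitz bound gives the price. -/
theorem IsStandardPotential.abs_logPartition_union_sub_le (hΦ : IsStandardPotential Φ)
    {D I : Finset (Site ν)} (h : Disjoint D I) :
    |logPartition Φ (D ∪ I) - (logPartition Φ D + logPartition Φ I)| ≤
      ‖partialHamiltonian Φ D (D ∪ I) - partialHamiltonian Φ D D‖ := by
  have hu := fun D => neg_mem (hΦ.partialHamiltonian_mem_univ D D)
  have hs := fun D => (hΦ.isSelfAdjoint_partialHamiltonian D D).neg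
  have h1 := log_trace_exp_add h (neg_mem (hΦ.partialHamiltonian_mem D D))
    (neg_mem (hΦ.partialHamiltonian_mem I I)) (hs D) (hs I)
    (by rw [map_neg, hΦ.theta_partialHamiltonian])
  rw [logPartition, logPartition, logPartition, ← h1]
  refine (abs_log_trace_exp_sub_le (hs _) ((hs D).add (hs I)) (hu _)
    (add_mem (hu D) (hu I))).trans (le_of_eq ?_)
  rw [partialHamiltonian_union, Finset.union_sdiff_cancel_left h, ← norm_neg]
  congr 1
  abel

/-- U(I) - U(D) = H_I(I \ D), whose norm is at most M per site. -/
theorem IsStandardPotential.abs_logPartition_sub_le_of_subset (hΦ : IsStandardPotential Φ) {M : ℝ}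
    (hM : ∀ n, ‖hamiltonian Φ {n}‖ ≤ M) {D I : Finset (Site ν)} (h : D ⊆ I) :
    |logPartition Φ I - logPartition Φ D| ≤ (I \ D).card * M := by
  refine (abs_log_trace_exp_sub_le (hΦ.isSelfAdjoint_partialHamiltonian I I).neg
    (hΦ.isSelfAdjoint_partialHamiltonian D D).neg (neg_mem (hΦ.partialHamiltonian_mem_univ I I))
    (neg_mem (hΦ.partialHamiltonian_mem_univ D D))).trans ?_
  have h1 := partialHamiltonian_union Φ (I \ D) D I
  rw [Finset.sdiff_union_of_subset h, Finset.sdiff_sdiff_eq_self h] at h1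
  rw [h1, neg_sub_neg, norm_sub_rev, add_sub_cancel_right]
  exact hΦ.norm_partialHamiltonian_le hM _ _

theorem abs_logPartition_sub_le {Ψ : Finset (Site ν) → Op ν} (hΦ : IsStandardPotential Φ)
    (hΨ : IsStandardPotential Ψ) (hd : IsStandardPotential (Φ - Ψ)) {M : ℝ}
    (hM : ∀ n, ‖hamiltonian (Φ - Ψ) {n}‖ ≤ M) (I : Finset (Site ν)) :
    |logPartition Φ I - logPartition Ψ I| ≤ I.card * M := by
  refine (abs_log_trace_exp_sub_le (hΦ.isSelfAdjoint_partialHamiltonian I I).neg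
    (hΨ.isSelfAdjoint_partialHamiltonian I I).neg (neg_mem (hΦ.partialHamiltonian_mem_univ I I))
    (neg_mem (hΨ.partialHamiltonian_mem_univ I I))).trans ?_
  have h1 : partialHamiltonian (Φ - Ψ) I I = partialHamiltonian Φ I I - partialHamiltonian Ψ I I :=
    Finset.sum_sub_distrib _ _
  rw [neg_sub_neg, norm_sub_rev, ← h1]
  exact hd.norm_partialHamiltonian_le hM _ _

theorem logPartition_convex {Ψ : Finset (Site ν) → Op ν} (hΦ : IsStandardPotential Φ)
    (hΨ : IsStandardPotential Ψ) {a b : ℝ} (ha : 0 ≤ a) (hb : 0 ≤ b) (hab : a + b = 1)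
    (I : Finset (Site ν)) :
    logPartition (a • Φ + b • Ψ) I ≤ a * logPartition Φ I + b * logPartition Ψ I := by
  have h1 : -partialHamiltonian (a • Φ + b • Ψ) I I =
      (a : ℂ) • (-partialHamiltonian Φ I I) + (b : ℂ) • (-partialHamiltonian Ψ I I) := by
    simp only [partialHamiltonian, Pi.add_apply, Pi.smul_apply, Finset.sum_add_distrib,
      ← Finset.smul_sum, real_smul_eq]
    module
  rw [logPartition, h1]
  exact log_trace_exp_convex (hΦ.isSelfAdjoint_partialHamiltonian I I).neg
    (hΨ.isSelfAdjoint_partialHamiltonian I I).neg (neg_mem (hΦ.partialHamiltonian_mem_univ I I))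
    (neg_mem (hΨ.partialHamiltonian_mem_univ I I)) ha hb hab

end LogPartition

/-! ### Cubes, their surfaces and the tiling of the lattice -/

section Cubes

variable (ν) in
/-- The cube `{0, …, a - 1}^ν`. -/
noncomputable def cube (a : ℕ) : Finset (Site ν) := Fintype.piFinset fun _ => Finset.Ico (0 : ℤ) a

/-- The translates of `cube ν a` that tile the lattice. -/
noncomputable def box (a : ℕ) (k : Site ν) : Finset (Site ν) := translate (cube ν a) fun i => a * k i

theorem card_cube (a : ℕ) : (cube ν a).card = a ^ ν := by
  simp [cube, Fintype.card_piFinset]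

theorem card_box (a : ℕ) (k : Site ν) : (box a k).card = (cube ν a).card := Finset.card_map _

theorem mem_box {a : ℕ} (ha : 0 < a) {k x : Site ν} : x ∈ box a k ↔ (fun i => x i / a) = k := by
  have ha' : (0 : ℤ) < a := by exact_mod_cast ha
  rw [box, mem_translate, cube, Fintype.mem_piFinset, funext_iff]
  refine forall_congr' fun i => ?_
  rw [Finset.mem_Ico, Pi.sub_apply, Int.ediv_eq_iff_of_pos ha']
  constructor <;> rintro ⟨h1, h2⟩ <;> constructor <;> linarith

theorem pairwiseDisjoint_box {a : ℕ} (ha : 0 < a) (s : Set (Site ν)) :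
    s.PairwiseDisjoint (box a) := by
  intro k _ l _ hkl
  refine Finset.disjoint_left.mpr fun x hx hx' => hkl ?_
  rw [← (mem_box ha).mp hx, ← (mem_box ha).mp hx']

/-- Euclidean distance dominates each coordinate difference, so a margin of ⌈r⌉₊ in every coordinate
already suffices; the margin used is one larger. -/
theorem surface_cube_subset (r : ℝ) (a : ℕ) :
    (cube ν a) \ surface r (cube ν a) ⊇
      Fintype.piFinset fun _ => Finset.Ico ((⌈r⌉₊ + 1 : ℕ) : ℤ) (a - (⌈r⌉₊ + 1 : ℕ)) := by
  classical
  intro n hn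
  rw [Fintype.mem_piFinset] at hn
  have hn' : n ∈ cube ν a := by
    rw [cube, Fintype.mem_piFinset]
    intro i
    have := Finset.mem_Ico.mp (hn i)
    rw [Finset.mem_Ico]
    push_cast at this
    constructor <;> linarith
  refine Finset.mem_sdiff.mpr ⟨hn', fun hs => ?_⟩
  obtain ⟨-, m, hm, hmr⟩ := Finset.mem_filter.mp hs
  refine hm ?_
  rw [cube, Fintype.mem_piFinset]
  intro i
  have h1 : |(m i : ℝ) - n i| ≤ r := by
    refine le_trans ?_ hmr
    rw [← Real.sqrt_sq_eq_abs]
    exact Real.sqrt_le_sqrt (Finset.single_le_sum (f := fun i => ((m i : ℝ) - n i) ^ 2)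
      (fun j _ => sq_nonneg _) (Finset.mem_univ i))
  have h2 := abs_le.mp (h1.trans (Nat.le_ceil r))
  have h3 := Finset.mem_Ico.mp (hn i)
  have h4 : -(⌈r⌉₊ : ℤ) ≤ m i - n i := by exact_mod_cast h2.1
  have h5 : m i - n i ≤ (⌈r⌉₊ : ℤ) := by exact_mod_cast h2.2
  rw [Finset.mem_Ico]
  push_cast at h3
  constructor <;> linarith

/-- Cubes form a van Hove sequence. -/
theorem tendsto_surface_cube (r : ℝ) :
    Tendsto (fun a : ℕ => ((surface r (cube ν a)).card : ℝ) / (cube ν a).card) atTop (𝓝 0) := by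
  set d : ℕ := ⌈r⌉₊ + 1 with hd
  -- An inner cube of side a - 2d misses the surface; this is the fraction it leaves over.
  have h1 : Tendsto (fun a : ℕ => 1 - (1 - (2 * d : ℝ) / a) ^ ν) atTop (𝓝 0) := by
    have h := tendsto_const_div_atTop_nhds_zero_nat (2 * d : ℝ)
    have h' := ((h.const_sub 1).pow ν).const_sub 1
    simpa using h'
  refine squeeze_zero' (Eventually.of_forall fun a => by positivity) ?_ h1
  filter_upwards [eventually_ge_atTop (2 * d + 1)] with a ha
  have ha0 : (0 : ℝ) < a := by exact_mod_cast (by omega : 0 < a)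
  have h2 := Finset.card_le_card (surface_cube_subset (ν := ν) r a)
  rw [Finset.card_sdiff_of_subset (surface_subset _ _), Fintype.card_piFinset] at h2
  simp only [Int.card_Ico, Finset.prod_const, Finset.card_univ, Fintype.card_fin] at h2
  have h3 : ((a : ℤ) - (⌈r⌉₊ + 1 : ℕ) - (⌈r⌉₊ + 1 : ℕ)).toNat = a - 2 * d := by omega
  rw [h3] at h2
  have h4 := Finset.card_le_card (surface_subset r (cube ν a))
  have h5 : (surface r (cube ν a)).card + (a - 2 * d) ^ ν ≤ (cube ν a).card := by omega
  have h6 : ((surface r (cube ν a)).card : ℝ) + ((a : ℝ) - 2 * d) ^ ν ≤ (a : ℝ) ^ ν := by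
    have h7 : (((surface r (cube ν a)).card + (a - 2 * d) ^ ν : ℕ) : ℝ) ≤ (cube ν a).card := by
      exact_mod_cast h5
    rw [card_cube] at h7
    push_cast [Nat.cast_sub (by omega : 2 * d ≤ a)] at h7
    exact h7
  rw [card_cube, Nat.cast_pow, div_le_iff₀ (by positivity), sub_mul, one_mul, ← mul_pow, sub_mul,
    div_mul_cancel₀ _ ha0.ne', one_mul]
  linarith

/-- The labels of the boxes inside `I`. -/
noncomputable def innerBoxes (a : ℕ) (I : Finset (Site ν)) : Finset (Site ν) :=
  {k ∈ I.image fun x i => x i / (a : ℤ) | box a k ⊆ I}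

theorem biUnion_innerBoxes_subset (a : ℕ) (I : Finset (Site ν)) :
    (innerBoxes a I).biUnion (box a) ⊆ I :=
  Finset.biUnion_subset.mpr fun _ hk => (Finset.mem_filter.mp hk).2

/-- The box of an uncovered site contains a point outside I, and two points of a box are at distance
at most a√ν. -/
theorem sdiff_innerBoxes_subset {a : ℕ} (ha : 0 < a) (I : Finset (Site ν)) :
    I \ (innerBoxes a I).biUnion (box a) ⊆ surface √(ν * (a : ℝ) ^ 2) I := by
  intro n hn
  obtain ⟨hnI, hn⟩ := Finset.mem_sdiff.mp hn
  by_contra hs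
  refine hn (Finset.mem_biUnion.mpr ⟨fun i => n i / a, Finset.mem_filter.mpr
    ⟨Finset.mem_image_of_mem _ hnI, fun m hm => ?_⟩, (mem_box ha).mpr rfl⟩)
  refine mem_of_notMem_surface hnI hs (Real.sqrt_le_sqrt ?_)
  calc ∑ i, ((m i : ℝ) - n i) ^ 2 ≤ ∑ _i : Fin ν, (a : ℝ) ^ 2 := by
        refine Finset.sum_le_sum fun i _ => ?_
        rw [sq_le_sq, Nat.abs_cast]
        have h1 := congrFun ((mem_box ha).mp hm) i
        have ha' : (0 : ℤ) < a := by exact_mod_cast ha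
        have e1 := Int.emod_add_mul_ediv (m i) a
        have e2 := Int.emod_add_mul_ediv (n i) a
        have e3 := Int.emod_nonneg (m i) ha'.ne'
        have e4 := Int.emod_lt_of_pos (m i) ha'
        have e5 := Int.emod_nonneg (n i) ha'.ne'
        have e6 := Int.emod_lt_of_pos (n i) ha'
        rw [h1] at e1
        have h2 : |m i - n i| ≤ (a : ℤ) := by
          rw [abs_le]
          constructor <;> linarith
        exact_mod_cast h2
    _ = ν * (a : ℝ) ^ 2 := by simp

end Cubes

/-! ### Existence of the pressure and van Hove limits -/

section Limit

variable {Φ : Finset (Site ν) → Op ν}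

/-- Boxes are added one at a time. Each new box pays for its own interaction with the union of the
previous ones; since `hb` is uniform in J, the price is b however large that union is. -/
theorem IsStandardPotential.abs_logPartition_biUnion_box_sub_le (hΦ : IsStandardPotential Φ)
    (hc : ∀ I k, shift k (Φ I) = Φ (translate I k)) {a : ℕ} (ha : 0 < a) {b : ℝ}
    (hb : ∀ J, cube ν a ⊆ J →
      ‖partialHamiltonian Φ (cube ν a) J - partialHamiltonian Φ (cube ν a) (cube ν a)‖ ≤ b)
    (s : Finset (Site ν)) :
    |logPartition Φ (s.biUnion (box a)) - s.card * logPartition Φ (cube ν a)| ≤ s.card * b := by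
  induction s using Finset.induction_on with
  | empty => simp [logPartition, partialHamiltonian, trace_one]
  | insert k s hk ih =>
    have hd : Disjoint (box a k) (s.biUnion (box a)) := by
      rw [Finset.disjoint_biUnion_right]
      exact fun l hl => pairwiseDisjoint_box ha Set.univ (Set.mem_univ k) (Set.mem_univ l)
        fun e => hk (e ▸ hl)
    have h1 := hΦ.abs_logPartition_union_sub_le hd
    have h2 : ∀ J, box a k ⊆ J →
        ‖partialHamiltonian Φ (box a k) J - partialHamiltonian Φ (box a k) (box a k)‖ ≤ b := by
      intro J hJ
      rw [← translate_translate_neg J fun i => a * k i] at hJ ⊢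
      rw [box, ← shift_partialHamiltonian hc, ← shift_partialHamiltonian hc, ← map_sub,
        norm_starAlgEquiv]
      exact hb _ ((translate_subset_translate _).mp hJ)
    have h3 : logPartition Φ (box a k) = logPartition Φ (cube ν a) :=
      hΦ.logPartition_translate hc _ _
    have h4 := abs_le.mp (h1.trans (h2 _ Finset.subset_union_left))
    have h5 := abs_le.mp ih
    rw [h3] at h4
    rw [Finset.biUnion_insert, Finset.card_insert_of_notMem hk, Nat.cast_add_one, abs_le]
    constructor <;> linarith [h4.1, h4.2, h5.1, h5.2]

/-- Three errors: discarding the uncovered sites costs ‖Φ‖ each, decoupling the boxes costs b per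
covered site, and counting |I| instead of the covered sites costs |q| per uncovered one. The
uncovered sites lie in the surface. -/
theorem IsStandardPotential.abs_logPartition_sub_cube_le (hΦ : IsStandardPotential Φ)
    (hc : ∀ I k, shift k (Φ I) = Φ (translate I k)) {a : ℕ} (ha : 0 < a) {b : ℝ} (hb0 : 0 ≤ b)
    (hb : ∀ J, cube ν a ⊆ J →
      ‖partialHamiltonian Φ (cube ν a) J - partialHamiltonian Φ (cube ν a) (cube ν a)‖ ≤
        b * (cube ν a).card)
    (I : Finset (Site ν)) :
    |logPartition Φ I - I.card * (logPartition Φ (cube ν a) / (cube ν a).card)| ≤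
      I.card * b + (surface √(ν * (a : ℝ) ^ 2) I).card *
        (potentialNorm Φ + |logPartition Φ (cube ν a) / (cube ν a).card|) := by
  set s := innerBoxes a I
  set q := logPartition Φ (cube ν a) / (cube ν a).card with hq
  set c : ℝ := ((cube ν a).card : ℝ) with hcdef
  set σ : ℝ := ((surface √(ν * (a : ℝ) ^ 2) I).card : ℝ)
  have hc0 : 0 < c := by
    rw [hcdef, card_cube]
    exact_mod_cast pow_pos ha ν
  have hsub := biUnion_innerBoxes_subset a I
  have h1 := hΦ.abs_logPartition_biUnion_box_sub_le hc ha hb s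
  have h2 := hΦ.abs_logPartition_sub_le_of_subset
    (fun n => (hΦ.norm_hamiltonian_singleton hc n).le) hsub
  have h3 : (((I \ s.biUnion (box a)).card : ℕ) : ℝ) ≤ σ := by
    exact Nat.cast_le.mpr (Finset.card_le_card (sdiff_innerBoxes_subset ha I))
  have h4 : ((s.biUnion (box a)).card : ℝ) = s.card * c := by
    rw [Finset.card_biUnion fun k hk l hl hkl => pairwiseDisjoint_box ha (s : Set (Site ν)) hk hl hkl]
    simp [card_box, hcdef]
  have h5 : (((I \ s.biUnion (box a)).card : ℕ) : ℝ) + s.card * c = I.card := by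
    rw [← h4]
    exact_mod_cast Finset.card_sdiff_add_card_eq_card hsub
  set ρ : ℝ := (((I \ s.biUnion (box a)).card : ℕ) : ℝ)
  have hρ : 0 ≤ ρ := Nat.cast_nonneg _
  have hM : 0 ≤ potentialNorm Φ := norm_nonneg _
  have h6 : logPartition Φ (cube ν a) = c * q := by rw [hq, mul_div_cancel₀ _ hc0.ne']
  rw [h6] at h1
  have h7 : logPartition Φ I - I.card * q = (logPartition Φ I - logPartition Φ (s.biUnion (box a))) +
      (logPartition Φ (s.biUnion (box a)) - s.card * (c * q)) - ρ * q := by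
    rw [← h5]
    ring
  have h8 : |ρ * q| ≤ σ * |q| := by
    rw [abs_mul, abs_of_nonneg hρ]
    gcongr
  have h9 : ρ * potentialNorm Φ ≤ σ * potentialNorm Φ := by gcongr
  have h10 : (s.card : ℝ) * (b * c) ≤ I.card * b := by
    rw [← h5]
    nlinarith [mul_nonneg hρ hb0]
  rw [h7]
  refine (abs_sub _ _).trans ?_
  have h11 := abs_add_le (logPartition Φ I - logPartition Φ (s.biUnion (box a)))
    (logPartition Φ (s.biUnion (box a)) - s.card * (c * q))
  linarith

/-- `|I|⁻¹ log τ(e^{-U(I)})` is nearly constant on the sets with a small surface. -/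
theorem IsStandardPotential.exists_logPartition_approx (hν : 1 ≤ ν) (hΦ : IsStandardPotential Φ)
    (hc : ∀ I k, shift k (Φ I) = Φ (translate I k)) {ε : ℝ} (hε : 0 < ε) :
    ∃ q r δ : ℝ, 0 < r ∧ 0 < δ ∧ ∀ I : Finset (Site ν), I.Nonempty →
      ((surface r I).card : ℝ) / I.card < δ → |logPartition Φ I / I.card - q| ≤ ε := by
  obtain ⟨r, hr, hb⟩ := hΦ.exists_surface_bound hc (show 0 < ε / 4 by positivity)
  have hM : 0 ≤ potentialNorm Φ := norm_nonneg _
  have ht := (tendsto_surface_cube (ν := ν) r).const_mul (2 * potentialNorm Φ)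
  rw [mul_zero] at ht
  -- The side a is so large that the decoupling cost b per site is below ε/2.
  obtain ⟨a, ha1, ha⟩ := ((ht.eventually_lt_const (show 0 < ε / 4 by positivity)).and
    (eventually_gt_atTop 0)).exists
  have hc0 : (0 : ℝ) < (cube ν a).card := by
    rw [card_cube]
    exact_mod_cast pow_pos ha ν
  set b : ℝ := 2 * potentialNorm Φ * ((surface r (cube ν a)).card / (cube ν a).card) + ε / 4
    with hbdef
  have hb0 : 0 ≤ b := by positivity
  have hbJ : ∀ J, cube ν a ⊆ J →
      ‖partialHamiltonian Φ (cube ν a) J - partialHamiltonian Φ (cube ν a) (cube ν a)‖ ≤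
        b * (cube ν a).card := by
    intro J hJ
    refine (hb _ J hJ).trans (le_of_eq ?_)
    rw [hbdef]
    field_simp
  set q := logPartition Φ (cube ν a) / (cube ν a).card with hq
  have hν' : (0 : ℝ) < ν := by exact_mod_cast hν
  have ha' : (0 : ℝ) < a := by exact_mod_cast ha
  -- The surface error gets the other ε/2; the summand 1 prevents division by zero. `hν` makes the
  -- radius positive.
  refine ⟨q, √(ν * (a : ℝ) ^ 2), ε / 2 / (potentialNorm Φ + |q| + 1), by positivity, by positivity,
    fun I hI hs => ?_⟩
  have hI0 : (0 : ℝ) < I.card := by exact_mod_cast hI.card_pos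
  have h1 := hΦ.abs_logPartition_sub_cube_le hc ha hb0 hbJ I
  have h2 : logPartition Φ I / I.card - q = (logPartition Φ I - I.card * q) / I.card := by
    field_simp
  rw [← hq] at h1
  rw [h2, abs_div, abs_of_pos hI0, div_le_iff₀ hI0]
  rw [lt_div_iff₀ (by positivity), div_mul_eq_mul_div, div_lt_iff₀ hI0] at hs
  have h3 : (0 : ℝ) ≤ (surface √(ν * (a : ℝ) ^ 2) I).card := Nat.cast_nonneg _
  have h4 : I.card * b ≤ I.card * (ε / 2) := by
    gcongr
    linarith
  linarith

theorem eventually_cube {r δ : ℝ} (hδ : 0 < δ) : ∀ᶠ a : ℕ in atTop,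
    (cube ν a).Nonempty ∧ ((surface r (cube ν a)).card : ℝ) / (cube ν a).card < δ := by
  filter_upwards [(tendsto_surface_cube (ν := ν) r).eventually_lt_const hδ,
    eventually_gt_atTop 0] with a h1 h2
  exact ⟨Finset.card_pos.mp (by rw [card_cube]; positivity), h1⟩

/-- The pressure, as the limit over cubes; it is approximated by all sets with a small surface. -/
theorem IsStandardPotential.exists_pressure (hν : 1 ≤ ν) (hΦ : IsStandardPotential Φ)
    (hc : ∀ I k, shift k (Φ I) = Φ (translate I k)) :
    ∃ p : ℝ, Tendsto (fun a : ℕ => logPartition Φ (cube ν a) / (cube ν a).card) atTop (𝓝 p) ∧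
      ∀ ε > 0, ∃ r δ : ℝ, 0 < r ∧ 0 < δ ∧ ∀ I : Finset (Site ν), I.Nonempty →
        ((surface r I).card : ℝ) / I.card < δ → |logPartition Φ I / I.card - p| ≤ ε := by
  -- The value q depends on ε. Cubes eventually qualify as sets with a small surface, so their
  -- densities are eventually within ε of q; this yields the Cauchy property and then |q - p| ≤ ε.
  have key : ∀ ε > 0, ∃ q r δ : ℝ, 0 < r ∧ 0 < δ ∧ (∀ I : Finset (Site ν), I.Nonempty →
      ((surface r I).card : ℝ) / I.card < δ → |logPartition Φ I / I.card - q| ≤ ε) ∧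
      ∀ᶠ a : ℕ in atTop, |logPartition Φ (cube ν a) / (cube ν a).card - q| ≤ ε := by
    intro ε hε
    obtain ⟨q, r, δ, hr, hδ, h⟩ := hΦ.exists_logPartition_approx hν hc hε
    exact ⟨q, r, δ, hr, hδ, h, (eventually_cube hδ).mono fun a ha => h _ ha.1 ha.2⟩
  have hcs : CauchySeq fun a : ℕ => logPartition Φ (cube ν a) / ((cube ν a).card : ℝ) := by
    refine Metric.cauchySeq_iff'.mpr fun ε hε => ?_
    obtain ⟨q, r, δ, hr, hδ, -, h⟩ := key (ε / 3) (by positivity)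
    obtain ⟨N, hN⟩ := eventually_atTop.mp h
    refine ⟨N, fun n hn => ?_⟩
    have h1 := abs_le.mp (hN n hn)
    have h2 := abs_le.mp (hN N le_rfl)
    rw [Real.dist_eq, abs_lt]
    constructor <;> linarith [h1.1, h1.2, h2.1, h2.2]
  obtain ⟨p, hp⟩ := cauchySeq_tendsto_of_complete hcs
  refine ⟨p, hp, fun ε hε => ?_⟩
  obtain ⟨q, r, δ, hr, hδ, h, h'⟩ := key (ε / 2) (by positivity)
  refine ⟨r, δ, hr, hδ, fun I hI hs => ?_⟩
  have h1 := abs_le.mp (h I hI hs)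
  have h2 := abs_le.mp (le_of_tendsto (hp.sub_const q).abs h')
  rw [abs_le]
  constructor <;> linarith [h1.1, h1.2, h2.1, h2.2]

/-- An estimate for single sets, with one radius and one threshold per ε, handles every net at once.
-/
theorem hasVanHoveLimit_of_approx {f : Finset (Site ν) → ℝ} {L : ℝ}
    (h : ∀ ε > 0, ∃ r δ : ℝ, 0 < r ∧ 0 < δ ∧ ∀ I : Finset (Site ν), I.Nonempty →
      ((surface r I).card : ℝ) / I.card < δ → |f I - L| ≤ ε) :
    HasVanHoveLimit.{w} f L := by
  intro A _ _ _ I hI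
  refine Metric.tendsto_nhds.mpr fun ε hε => ?_
  obtain ⟨r, δ, hr, hδ, h⟩ := h (ε / 2) (by positivity)
  filter_upwards [hI.1, (hI.2 r hr).eventually_lt_const hδ] with α h1 h2
  rw [Real.dist_eq]
  linarith [h (I α) h1 h2]

theorem IsStandardPotential.hasVanHoveLimit_internalEnergy (hΦ : IsStandardPotential Φ) {p : ℝ}
    (h : ∀ ε > 0, ∃ r δ : ℝ, 0 < r ∧ 0 < δ ∧ ∀ I : Finset (Site ν), I.Nonempty →
      ((surface r I).card : ℝ) / I.card < δ → |logPartition Φ I / I.card - p| ≤ ε) :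
    HasVanHoveLimit.{w} (logTraceDensity (internalEnergy Φ)) p := by
  have e : logTraceDensity (internalEnergy Φ) = fun I => logPartition Φ I / I.card := by
    funext I
    rw [logTraceDensity, hΦ.internalEnergy_eq, logPartition, one_div_mul_eq_div]
  rw [e]
  exact hasVanHoveLimit_of_approx h

theorem IsStandardPotential.hasVanHoveLimit_hamiltonian (hΦ : IsStandardPotential Φ)
    (hc : ∀ I k, shift k (Φ I) = Φ (translate I k)) {p : ℝ}
    (h : HasVanHoveLimit.{w} (logTraceDensity (internalEnergy Φ)) p) :
    HasVanHoveLimit.{w} (logTraceDensity (hamiltonian Φ)) p := by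
  have h0 : HasVanHoveLimit.{w} (fun I => logTraceDensity (hamiltonian Φ) I -
      logTraceDensity (internalEnergy Φ) I) 0 := by
    refine hasVanHoveLimit_of_approx fun ε hε => ?_
    obtain ⟨r, hr, hb⟩ := hΦ.exists_surface_bound hc (half_pos hε)
    have hM : 0 ≤ potentialNorm Φ := norm_nonneg _
    refine ⟨r, ε / 2 / (2 * potentialNorm Φ + 1), hr, by positivity, fun I hI hs => ?_⟩
    have hI0 : (0 : ℝ) < I.card := by exact_mod_cast hI.card_pos
    have h1 := hΦ.abs_log_trace_exp_hamiltonian_sub_le (hb I)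
    rw [sub_zero, logTraceDensity, logTraceDensity, hΦ.internalEnergy_eq, ← mul_sub,
      one_div_mul_eq_div, abs_div, abs_of_pos hI0, div_le_iff₀ hI0]
    rw [lt_div_iff₀ (by positivity), div_mul_eq_mul_div, div_lt_iff₀ hI0] at hs
    have h2 : (0 : ℝ) ≤ (surface r I).card := Nat.cast_nonneg _
    linarith
  intro A _ _ _ I hI
  simpa using (h0 A I hI).add (h A I hI)

end Limit

end Fermion

theorem mainTheorem12 (ν : ℕ) (hν : 1 ≤ ν) :
    ∃ p : Fermion.covariantPotentials ν → ℝ,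
      (∀ Φ : Fermion.covariantPotentials ν,
        Fermion.HasVanHoveLimit.{w} (Fermion.logTraceDensity (Fermion.hamiltonian Φ.1)) (p Φ) ∧
        Fermion.HasVanHoveLimit.{w} (Fermion.logTraceDensity (Fermion.internalEnergy Φ.1)) (p Φ)) ∧
      ConvexOn ℝ Set.univ p ∧
      ∀ Φ Ψ : Fermion.covariantPotentials ν,
        |p Φ - p Ψ| ≤ Fermion.potentialNorm (Φ - Ψ).1 := by
  have hs : ∀ Φ : Fermion.covariantPotentials ν, Fermion.IsStandardPotential Φ.1 := fun Φ => Φ.2.1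
  choose p hp hp' using fun Φ : Fermion.covariantPotentials ν =>
    (hs Φ).exists_pressure hν Φ.2.2
  refine ⟨p, fun Φ => ?_, ⟨convex_univ, fun Φ _ Ψ _ a b ha hb hab => ?_⟩, fun Φ Ψ => ?_⟩
  · have h := (hs Φ).hasVanHoveLimit_internalEnergy (hp' Φ)
    exact ⟨(hs Φ).hasVanHoveLimit_hamiltonian Φ.2.2 h, h⟩
  · refine le_of_tendsto_of_tendsto' (hp _) (((hp Φ).const_mul a).add ((hp Ψ).const_mul b))
      fun n => ?_
    rw [← mul_div_assoc, ← mul_div_assoc, ← add_div]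
    exact div_le_div_of_nonneg_right
      (Fermion.logPartition_convex (hs Φ) (hs Ψ) ha hb hab _) (Nat.cast_nonneg _)
  · refine le_of_tendsto ((hp Φ).sub (hp Ψ)).abs ?_
    -- Only nonemptiness of the cubes is used; the radius and the threshold are arbitrary.
    filter_upwards [Fermion.eventually_cube (ν := ν) (r := 1) one_pos] with n hn
    have hc0 : (0 : ℝ) < (Fermion.cube ν n).card := by exact_mod_cast hn.1.card_pos
    rw [← sub_div, abs_div, abs_of_pos hc0, div_le_iff₀ hc0, mul_comm]
    exact Fermion.abs_logPartition_sub_le (hs Φ) (hs Ψ) (hs (Φ - Ψ))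
      (fun m => ((hs (Φ - Ψ)).norm_hamiltonian_singleton (Φ - Ψ).2.2 m).le) _
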